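/- Let $(\bar M,\bar g)$ be a connected smooth Riemannian manifold of dimension $n+1$ with Levi-Civita connection $\bar\nabla$, and let $i: M\to \bar M$ be an $n$-dimensional extrinsic hypersphere. That is, $M$ is a non-empty complete hypersurface with induced metric $g$, Levi-Civita connection $\nabla$ and smooth unit normal vector field $N$, whose second fundamental form satisfies $$\bar\nabla_XY-\nabla_XY=\lambda\, g(X,Y)\,N$$ for all vector fields $X,Y$ tangent to $M$ and some real constant $\lambda\neq 0$ (equivalently, $\bar\nabla_XN=-\lambda X$ for all $X$ tangent to $M$). Let $1\le k\le n$, let $\sigma$ be a parallel differential $k$-form on $\bar M$ which is not identically zero, and put $$\gamma:=i^*(N\lrcorner\,\sigma),\qquad \beta:=i^*\sigma .$$ Then $\gamma$ is a smooth $(k-1)$-form and $\beta$ is a smooth $k$-form on $M$, and for every tangent vector $X$ of $M$ $$\begin{array}{lrl} (i) & \nabla_X\gamma &= \frac1k\, X\lrcorner\, d\gamma,\\ (ii) & \nabla_X d\gamma &= -k\lambda^2\, X\wedge\gamma,\\ (iii) & \nabla_X\beta &= -\frac1{n-k+1}\, X\wedge d^*\beta,\\ (iv) & \nabla_X d^*\beta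 &= (n-k+1)\lambda^2\, X\lrcorner\,\beta, \end{array}$$ where in $X\wedge\cdot$ the vector $X$ is identified with its dual $1$-form $g(X,\cdot)$ and $d^*=-\sum_j e_j\lrcorner\nabla_{e_j}$ for orthonormal bases $(e_j)$ of the tangent spaces of $M$. Moreover $$d\gamma=-k\lambda\,\beta,\qquad d^*\beta=-(n-k+1)\lambda\,\gamma ,$$ $\gamma$ is coclosed ($d^*\gamma=0$; an empty condition if $k=1$), $\beta$ is closed ($d\beta=0$), and $\gamma$ is not parallel. -/

import Mathlib

open scoped Manifold ContDiff Bundle Topology InnerProductSpace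
open Bundle VectorField FiberBundle

set_option linter.unusedSectionVars false

noncomputable section

namespace RiemGeom

section LeviCivita

variable {E : Type*} [NormedAddCommGroup E] [NormedSpace ℝ E] [FiniteDimensional ℝ E]
  {M : Type*} [TopologicalSpace M] [ChartedSpace E M] [IsManifold 𝓘(ℝ, E) ∞ M]
  [RiemannianBundle (fun x : M ↦ TangentSpace 𝓘(ℝ, E) x)]

/-- The right-hand side of the Koszul formula for `⟪∇_X Y, Z⟫`. -/
def koszul (Y X Z : Π x : M, TangentSpace 𝓘(ℝ, E) x) (x : M) : ℝ :=
  (1 / 2 : ℝ) * (mvfderiv 𝓘(ℝ, E) (fun y ↦ ⟪Y y, Z y⟫_ℝ) x (X x)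
    + mvfderiv 𝓘(ℝ, E) (fun y ↦ ⟪Z y, X y⟫_ℝ) x (Y x)
    - mvfderiv 𝓘(ℝ, E) (fun y ↦ ⟪X y, Y y⟫_ℝ) x (Z x)
    + ⟪mlieBracket 𝓘(ℝ, E) X Y x, Z x⟫_ℝ
    - ⟪mlieBracket 𝓘(ℝ, E) Y Z x, X x⟫_ℝ
    + ⟪mlieBracket 𝓘(ℝ, E) Z X x, Y x⟫_ℝ)

variable [IsContMDiffRiemannianBundle 𝓘(ℝ, E) ∞ E (fun x : M ↦ TangentSpace 𝓘(ℝ, E) x)]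
  {X X' Y Y' Z Z' : Π x : M, TangentSpace 𝓘(ℝ, E) x} {f : M → ℝ} {x : M}

theorem mdifferentiableAt_inner (hY : MDiffAt (T% Y) x) (hZ : MDiffAt (T% Z) x) :
    MDiffAt (fun y ↦ ⟪Y y, Z y⟫_ℝ) x :=
  MDifferentiableAt.inner_bundle (E := fun x : M ↦ TangentSpace 𝓘(ℝ, E) x) (F := E)
    (IB := 𝓘(ℝ, E)) (b := id) hY hZ

theorem mvfderiv_inner_add_left (hY : MDiffAt (T% Y) x) (hY' : MDiffAt (T% Y') x)
    (hZ : MDiffAt (T% Z) x) :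
    mvfderiv 𝓘(ℝ, E) (fun y ↦ ⟪(Y + Y') y, Z y⟫_ℝ) x =
      mvfderiv 𝓘(ℝ, E) (fun y ↦ ⟪Y y, Z y⟫_ℝ) x + mvfderiv 𝓘(ℝ, E) (fun y ↦ ⟪Y' y, Z y⟫_ℝ) x := by
  simpa [inner_add_left] using
    mvfderiv_fun_add (mdifferentiableAt_inner hY hZ) (mdifferentiableAt_inner hY' hZ)

theorem mvfderiv_inner_smul_left (hf : MDiffAt f x) (hY : MDiffAt (T% Y) x)
    (hZ : MDiffAt (T% Z) x) :
    mvfderiv 𝓘(ℝ, E) (fun y ↦ ⟪(f • Y) y, Z y⟫_ℝ) x =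
      f x • mvfderiv 𝓘(ℝ, E) (fun y ↦ ⟪Y y, Z y⟫_ℝ) x + ⟪Y x, Z x⟫_ℝ • mvfderiv 𝓘(ℝ, E) f x := by
  simpa [inner_smul_left] using mvfderiv_fun_mul hf (mdifferentiableAt_inner hY hZ)

theorem mvfderiv_inner_add_right (hY : MDiffAt (T% Y) x) (hY' : MDiffAt (T% Y') x)
    (hZ : MDiffAt (T% Z) x) :
    mvfderiv 𝓘(ℝ, E) (fun y ↦ ⟪Z y, (Y + Y') y⟫_ℝ) x =
      mvfderiv 𝓘(ℝ, E) (fun y ↦ ⟪Z y, Y y⟫_ℝ) x + mvfderiv 𝓘(ℝ, E) (fun y ↦ ⟪Z y, Y' y⟫_ℝ) x := by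
  simpa [inner_add_right] using
    mvfderiv_fun_add (mdifferentiableAt_inner hZ hY) (mdifferentiableAt_inner hZ hY')

theorem mvfderiv_inner_smul_right (hf : MDiffAt f x) (hY : MDiffAt (T% Y) x)
    (hZ : MDiffAt (T% Z) x) :
    mvfderiv 𝓘(ℝ, E) (fun y ↦ ⟪Z y, (f • Y) y⟫_ℝ) x =
      f x • mvfderiv 𝓘(ℝ, E) (fun y ↦ ⟪Z y, Y y⟫_ℝ) x + ⟪Z x, Y x⟫_ℝ • mvfderiv 𝓘(ℝ, E) f x := by
  simpa [inner_smul_right] using mvfderiv_fun_mul hf (mdifferentiableAt_inner hZ hY)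

theorem koszul_add (hY : MDiffAt (T% Y) x) (hY' : MDiffAt (T% Y') x) (hX : MDiffAt (T% X) x)
    (hZ : MDiffAt (T% Z) x) : koszul (Y + Y') X Z x = koszul Y X Z x + koszul Y' X Z x := by
  rw [koszul, mvfderiv_inner_add_left hY hY' hZ, mvfderiv_inner_add_right hY hY' hX,
    mlieBracket_add_left hY hY', mlieBracket_add_right hY hY']
  simp [koszul, inner_add_left, inner_add_right]
  ring

theorem koszul_leibniz (hf : MDiffAt f x) (hY : MDiffAt (T% Y) x) (hX : MDiffAt (T% X) x)
    (hZ : MDiffAt (T% Z) x) :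
    koszul (f • Y) X Z x = f x * koszul Y X Z x + mvfderiv 𝓘(ℝ, E) f x (X x) * ⟪Y x, Z x⟫_ℝ := by
  rw [koszul, mvfderiv_inner_smul_left hf hY hZ, mvfderiv_inner_smul_right hf hY hX,
    mlieBracket_smul_left hf hY, mlieBracket_smul_right hf hY]
  simp [koszul, inner_add_left, inner_smul_left, inner_smul_right, real_inner_comm]
  ring

theorem koszul_tensorial_left (hY : MDiffAt (T% Y) x) (hZ : MDiffAt (T% Z) x) :
    TensorialAt 𝓘(ℝ, E) E (fun X ↦ koszul Y X Z x) x where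
  smul {f X} hf hX := by
    simp only [koszul, mlieBracket_smul_left hf hX, mlieBracket_smul_right hf hX,
      mvfderiv_inner_smul_left hf hX hY, mvfderiv_inner_smul_right hf hX hZ]
    simp [inner_add_left, inner_smul_left, inner_smul_right, real_inner_comm]
    ring
  add {X X'} hX hX' := by
    simp only [koszul, mlieBracket_add_left hX hX', mlieBracket_add_right hX hX',
      mvfderiv_inner_add_left hX hX' hY, mvfderiv_inner_add_right hX hX' hZ]
    simp [inner_add_left, inner_add_right]
    ring

theorem koszul_tensorial_right (hY : MDiffAt (T% Y) x) (hX : MDiffAt (T% X) x) :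
    TensorialAt 𝓘(ℝ, E) E (fun Z ↦ koszul Y X Z x) x where
  smul {f Z} hf hZ := by
    simp only [koszul, mlieBracket_smul_left hf hZ, mlieBracket_smul_right hf hZ,
      mvfderiv_inner_smul_left hf hZ hX, mvfderiv_inner_smul_right hf hZ hY]
    simp [inner_add_left, inner_smul_left, inner_smul_right, real_inner_comm]
    ring
  add {Z Z'} hZ hZ' := by
    simp only [koszul, mlieBracket_add_left hZ hZ', mlieBracket_add_right hZ hZ',
      mvfderiv_inner_add_left hZ hZ' hX, mvfderiv_inner_add_right hZ hZ' hY]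
    simp [inner_add_left, inner_add_right]
    ring

/-- The bilinear form `(X, Z) ↦ ⟪∇_X Y, Z⟫` at `x` given by the Koszul formula. -/
def koszulForm (Y : Π x : M, TangentSpace 𝓘(ℝ, E) x) (x : M) (hY : MDiffAt (T% Y) x) :
    TangentSpace 𝓘(ℝ, E) x →L[ℝ] TangentSpace 𝓘(ℝ, E) x →L[ℝ] ℝ :=
  TensorialAt.mkHom₂ (fun X Z ↦ koszul Y X Z x) x
    (fun _ hZ ↦ koszul_tensorial_left hY hZ) (fun _ hX ↦ koszul_tensorial_right hY hX)

theorem koszulForm_apply (hY : MDiffAt (T% Y) x) (hX : MDiffAt (T% X) x)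
    (hZ : MDiffAt (T% Z) x) : koszulForm Y x hY (X x) (Z x) = koszul Y X Z x :=
  TensorialAt.mkHom₂_apply _ _ hX hZ

instance (x : M) : FiniteDimensional ℝ (TangentSpace 𝓘(ℝ, E) x) :=
  inferInstanceAs (FiniteDimensional ℝ E)

instance (x : M) : CompleteSpace (TangentSpace 𝓘(ℝ, E) x) :=
  FiniteDimensional.complete ℝ _

open Classical in
/-- The derivative `X ↦ ∇_X Y` at `x`: the vector representing the Koszul form. At points where
`Y` is not differentiable the value is `0`. -/
def leviCivitaFun (Y : Π x : M, TangentSpace 𝓘(ℝ, E) x) (x : M) :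
    TangentSpace 𝓘(ℝ, E) x →L[ℝ] TangentSpace 𝓘(ℝ, E) x :=
  if hY : MDiffAt (T% Y) x then
    LinearMap.toContinuousLinearMap
      { toFun := fun X ↦ (InnerProductSpace.toDual ℝ (TangentSpace 𝓘(ℝ, E) x)).symm
          (koszulForm Y x hY X)
        map_add' := by simp
        map_smul' := by simp }
  else 0

theorem inner_leviCivitaFun (hY : MDiffAt (T% Y) x) (v w : TangentSpace 𝓘(ℝ, E) x) :
    ⟪leviCivitaFun Y x v, w⟫_ℝ = koszulForm Y x hY v w := by
  simp [leviCivitaFun, hY]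

theorem inner_leviCivitaFun_field (hY : MDiffAt (T% Y) x) (hX : MDiffAt (T% X) x)
    (hZ : MDiffAt (T% Z) x) : ⟪leviCivitaFun Y x (X x), Z x⟫_ℝ = koszul Y X Z x := by
  rw [inner_leviCivitaFun hY, koszulForm_apply hY hX hZ]

variable (E M) in
/-- The Levi-Civita connection of a Riemannian manifold; `leviCivita E M Y x v` is `(∇_v Y) x`. -/
def leviCivita : CovariantDerivative 𝓘(ℝ, E) E (fun x : M ↦ TangentSpace 𝓘(ℝ, E) x) where
  toFun := leviCivitaFun
  isCovariantDerivativeOnUniv :=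
    { add := by
        intro Y Y' x hY hY' _
        ext v
        refine ext_inner_right ℝ fun w ↦ ?_
        obtain ⟨X, hX, rfl⟩ : ∃ X : Π x : M, TangentSpace 𝓘(ℝ, E) x, MDiffAt (T% X) x ∧ X x = v :=
          ⟨extend E v, mdifferentiableAt_extend .., by simp⟩
        obtain ⟨Z, hZ, rfl⟩ : ∃ Z : Π x : M, TangentSpace 𝓘(ℝ, E) x, MDiffAt (T% Z) x ∧ Z x = w :=
          ⟨extend E w, mdifferentiableAt_extend .., by simp⟩
        rw [inner_leviCivitaFun_field (mdifferentiableAt_add_section hY hY') hX hZ,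
          koszul_add hY hY' hX hZ, add_apply, inner_add_left,
          inner_leviCivitaFun_field hY hX hZ, inner_leviCivitaFun_field hY' hX hZ]
      leibniz := by
        intro Y f x hY hf _
        ext v
        refine ext_inner_right ℝ fun w ↦ ?_
        obtain ⟨X, hX, rfl⟩ : ∃ X : Π x : M, TangentSpace 𝓘(ℝ, E) x, MDiffAt (T% X) x ∧ X x = v :=
          ⟨extend E v, mdifferentiableAt_extend .., by simp⟩
        obtain ⟨Z, hZ, rfl⟩ : ∃ Z : Π x : M, TangentSpace 𝓘(ℝ, E) x, MDiffAt (T% Z) x ∧ Z x = w :=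
          ⟨extend E w, mdifferentiableAt_extend .., by simp⟩
        rw [inner_leviCivitaFun_field (hf.smul_section hY) hX hZ,
          koszul_leibniz hf hY hX hZ, add_apply, inner_add_left,
          smul_apply, inner_smul_left,
          inner_leviCivitaFun_field hY hX hZ]
        simp [inner_smul_left] }

theorem inner_fun_comm (X Y : Π x : M, TangentSpace 𝓘(ℝ, E) x) :
    (fun y ↦ ⟪X y, Y y⟫_ℝ) = fun y ↦ ⟪Y y, X y⟫_ℝ :=
  funext fun _ ↦ real_inner_comm _ _

/-- The Levi-Civita connection is torsion-free. -/
theorem leviCivita_torsion : (leviCivita E M).torsion = 0 := by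
  rw [CovariantDerivative.torsion_eq_zero_iff]
  intro X Y x hX hY
  refine ext_inner_right ℝ fun w ↦ ?_
  obtain ⟨Z, hZ, rfl⟩ : ∃ Z : Π x : M, TangentSpace 𝓘(ℝ, E) x, MDiffAt (T% Z) x ∧ Z x = w :=
    ⟨extend E w, mdifferentiableAt_extend .., by simp⟩
  rw [inner_sub_left]
  change ⟪leviCivitaFun Y x (X x), Z x⟫_ℝ - ⟪leviCivitaFun X x (Y x), Z x⟫_ℝ = _
  rw [inner_leviCivitaFun_field hY hX hZ, inner_leviCivitaFun_field hX hY hZ]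
  rw [koszul, koszul, mlieBracket_swap_apply (V := Y) (W := X),
    mlieBracket_swap_apply (V := X) (W := Z), mlieBracket_swap_apply (V := Z) (W := Y),
    inner_fun_comm Z X, inner_fun_comm Z Y, inner_fun_comm X Y]
  simp only [inner_neg_left]
  ring

/-- The Levi-Civita connection is compatible with the metric. -/
theorem leviCivita_metric (hX : MDiffAt (T% X) x) (hY : MDiffAt (T% Y) x)
    (hZ : MDiffAt (T% Z) x) : mvfderiv 𝓘(ℝ, E) (fun y ↦ ⟪Y y, Z y⟫_ℝ) x (X x) =
      ⟪leviCivita E M Y x (X x), Z x⟫_ℝ + ⟪Y x, leviCivita E M Z x (X x)⟫_ℝ := by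
  change _ = ⟪leviCivitaFun Y x (X x), Z x⟫_ℝ + ⟪Y x, leviCivitaFun Z x (X x)⟫_ℝ
  rw [← real_inner_comm (Y x), inner_leviCivitaFun_field hY hX hZ,
    inner_leviCivitaFun_field hZ hX hY]
  rw [koszul, koszul, mlieBracket_swap_apply (V := Z) (W := Y),
    mlieBracket_swap_apply (V := X) (W := Z), mlieBracket_swap_apply (V := Y) (W := X),
    inner_fun_comm Z X, inner_fun_comm Z Y, inner_fun_comm X Y]
  simp only [inner_neg_left]
  ring

end LeviCivita

section Algebra

variable {V : Type*} [AddCommGroup V] [Module ℝ V] [TopologicalSpace V] {k : ℕ}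

/-- Interior product: `(v ⌟ α)(v₁, …, vₖ) = α(v, v₁, …, vₖ)`. -/
def interiorProd (v : V) (α : V [⋀^Fin (k + 1)]→L[ℝ] ℝ) : V [⋀^Fin k]→L[ℝ] ℝ :=
  { α.toAlternatingMap.curryLeft v with
    cont := by
      change Continuous fun m : Fin k → V ↦ α (Matrix.vecCons v m)
      exact α.cont.comp (continuous_const.matrixVecCons continuous_id) }

theorem interiorProd_apply (v : V) (α : V [⋀^Fin (k + 1)]→L[ℝ] ℝ) (m : Fin k → V) :
    interiorProd v α m = α (Matrix.vecCons v m) := rfl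

/-- Exterior product of a covector with an alternating form:
`(l ∧ α)(v₀, …, vₖ) = ∑ᵢ (-1)ⁱ l(vᵢ) α(v₀, …, v̂ᵢ, …, vₖ)`. -/
def wedge (l : V →L[ℝ] ℝ) (α : V [⋀^Fin k]→L[ℝ] ℝ) : V [⋀^Fin (k + 1)]→L[ℝ] ℝ :=
  { AlternatingMap.alternatizeUncurryFin (l.toLinearMap.smulRight α.toAlternatingMap) with
    cont := by
      have h : Continuous fun m : Fin (k + 1) → V ↦
          ∑ i : Fin (k + 1), (-1 : ℝ) ^ (i : ℕ) * (l (m i) * α (i.removeNth m)) := by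
        refine continuous_finsetSum _ fun i _ ↦ continuous_const.mul (Continuous.mul ?_ ?_)
        · exact l.continuous.comp (continuous_apply i)
        · exact α.cont.comp (continuous_pi fun j ↦ continuous_apply _)
      convert h using 2 with m
      simp [AlternatingMap.alternatizeUncurryFin_apply] }

theorem wedge_apply (l : V →L[ℝ] ℝ) (α : V [⋀^Fin k]→L[ℝ] ℝ) (m : Fin (k + 1) → V) :
    wedge l α m = ∑ i : Fin (k + 1), (-1) ^ (i : ℕ) * (l (m i) * α (i.removeNth m)) := by
  change AlternatingMap.alternatizeUncurryFin (l.toLinearMap.smulRight α.toAlternatingMap) m = _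
  simp [AlternatingMap.alternatizeUncurryFin_apply]

/-- The derivation action of an endomorphism on alternating forms:
`(A · α)(v₁, …, vₖ) = ∑ⱼ α(v₁, …, A vⱼ, …, vₖ)`. -/
def endAct (A : V →L[ℝ] V) (α : V [⋀^Fin k]→L[ℝ] ℝ) : V [⋀^Fin k]→L[ℝ] ℝ where
  toFun v := ∑ j, α (Function.update v j (A (v j)))
  map_update_add' := by
    intro inst m i x y
    obtain rfl := Subsingleton.elim (instDecidableEqFin k) inst
    rw [← Finset.sum_add_distrib]
    refine Finset.sum_congr rfl fun j _ ↦ ?_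
    by_cases h : j = i
    · subst h
      simp only [Function.update_idem, Function.update_self, map_add, α.map_update_add]
    · rw [Function.update_of_ne h, Function.update_of_ne h, Function.update_of_ne h,
        Function.update_comm (Ne.symm h), Function.update_comm (Ne.symm h),
        Function.update_comm (Ne.symm h), α.map_update_add]
  map_update_smul' := by
    intro inst m i c x
    obtain rfl := Subsingleton.elim (instDecidableEqFin k) inst
    rw [Finset.smul_sum]
    refine Finset.sum_congr rfl fun j _ ↦ ?_
    by_cases h : j = i
    · subst h
      rw [Function.update_idem, Function.update_idem, Function.update_self, Function.update_self,
        map_smul, α.map_update_smul]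
    · rw [Function.update_of_ne h, Function.update_of_ne h, Function.update_comm (Ne.symm h),
        Function.update_comm (Ne.symm h), α.map_update_smul]
  map_eq_zero_of_eq' := by
    intro v a b hab hne
    rw [Finset.sum_eq_add a b hne]
    · have h : Function.update v b (A (v b)) =
          Function.update v a (A (v a)) ∘ Equiv.swap a b := by
        funext j
        by_cases hja : j = a
        · subst hja; simp [Function.update_of_ne hne, Function.update_of_ne hne.symm, hab]
        · by_cases hjb : j = b
          · subst hjb; simp [hab]
          · simp [Equiv.swap_apply_of_ne_of_ne hja hjb, hja, hjb]
      change α.toAlternatingMap (Function.update v a (A (v a))) +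
        α.toAlternatingMap (Function.update v b (A (v b))) = 0
      rw [h, α.toAlternatingMap.map_swap _ hne]
      simp
    · intro c _ hc
      refine α.map_eq_zero_of_eq _ ?_ hne
      rw [Function.update_of_ne hc.1.symm, Function.update_of_ne hc.2.symm, hab]
    · simp
    · simp
  cont := by
    refine continuous_finsetSum _ fun j _ ↦ α.cont.comp ?_
    exact continuous_id.update j (A.continuous.comp (continuous_apply j))

end Algebra

section Forms

variable {E : Type*} [NormedAddCommGroup E] [NormedSpace ℝ E]
  {M : Type*} [TopologicalSpace M] [ChartedSpace E M]

variable (E M) in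
/-- A field of alternating `k`-forms on the tangent spaces of `M`. -/
abbrev FormField (k : ℕ) : Type _ := Π x : M, TangentSpace 𝓘(ℝ, E) x [⋀^Fin k]→L[ℝ] ℝ

variable {k : ℕ}

/-- `α` is a differential form: a smooth section of the bundle of alternating forms. -/
def IsSmoothForm [IsManifold 𝓘(ℝ, E) ∞ M] (α : FormField E M k) : Prop :=
  ContMDiff 𝓘(ℝ, E) (𝓘(ℝ, E).prod 𝓘(ℝ, E [⋀^Fin k]→L[ℝ] ℝ)) ∞
    (fun x ↦ TotalSpace.mk' (E [⋀^Fin k]→L[ℝ] ℝ)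
      (E := fun x : M ↦ TangentSpace 𝓘(ℝ, E) x [⋀^Fin k]→L[ℝ] Bundle.Trivial M ℝ x) x (α x))

/-- The form `α` read in the preferred chart at `x₀`, i.e. its pullback under the inverse chart. -/
def chartForm (α : FormField E M k) (x₀ : M) (u : E) : E [⋀^Fin k]→L[ℝ] ℝ :=
  (α ((extChartAt 𝓘(ℝ, E) x₀).symm u)).compContinuousLinearMap
    (mfderiv 𝓘(ℝ, E) 𝓘(ℝ, E) (extChartAt 𝓘(ℝ, E) x₀).symm u :)

/-- Exterior derivative: read the form in the preferred chart at `x`, differentiate there, and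
pull the result back by the chart. -/
def extD (α : FormField E M k) : FormField E M (k + 1) := fun x ↦
  (extDeriv (chartForm α x) (extChartAt 𝓘(ℝ, E) x x)).compContinuousLinearMap
    (mvfderiv 𝓘(ℝ, E) (extChartAt 𝓘(ℝ, E) x) x)

section Hypersurface

variable {F : Type*} [NormedAddCommGroup F] [NormedSpace ℝ F] {P : Type*}
  [TopologicalSpace P] [ChartedSpace F P]

/-- The pullback `i^* σ`. -/
def pullbackForm (i : M → P) (σ : FormField F P k) : FormField E M k := fun x ↦
  (σ (i x)).compContinuousLinearMap (mfderiv 𝓘(ℝ, E) 𝓘(ℝ, F) i x)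

/-- The pullback `i^* (N ⌟ σ)`, where `N` is a vector field along `i`. -/
def pullbackInterior (i : M → P) (N : Π x : M, TangentSpace 𝓘(ℝ, F) (i x))
    (σ : FormField F P (k + 1)) : FormField E M k := fun x ↦
  (interiorProd (N x) (σ (i x))).compContinuousLinearMap (mfderiv 𝓘(ℝ, E) 𝓘(ℝ, F) i x)

end Hypersurface

variable [FiniteDimensional ℝ E] [IsManifold 𝓘(ℝ, E) ∞ M]
  [RiemannianBundle (fun x : M ↦ TangentSpace 𝓘(ℝ, E) x)]

/-- The metric dual covector `⟪v, ·⟫` of a tangent vector. -/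
def flat {x : M} (v : TangentSpace 𝓘(ℝ, E) x) : TangentSpace 𝓘(ℝ, E) x →L[ℝ] ℝ := innerSL ℝ v

theorem extend_add {x : M} (v w : TangentSpace 𝓘(ℝ, E) x) :
    ∀ᶠ y in 𝓝 x, extend E (v + w) y = (extend E v + extend E w) y := by
  set e := trivializationAt E (TangentSpace 𝓘(ℝ, E)) x with he
  filter_upwards [e.open_baseSet.mem_nhds (FiberBundle.mem_baseSet_trivializationAt' x)] with y hy
  have h : (e ⟨x, v + w⟩).2 = (e ⟨x, v⟩).2 + (e ⟨x, w⟩).2 :=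
    (e.linear ℝ (FiberBundle.mem_baseSet_trivializationAt' x)).map_add v w
  have h' := (e.symmₗ ℝ y).map_add (e ⟨x, v⟩).2 (e ⟨x, w⟩).2
  rw [e.coe_symmₗ hy] at h'
  change e.symm y (e ⟨x, v + w⟩).2 = e.symm y (e ⟨x, v⟩).2 + e.symm y (e ⟨x, w⟩).2
  rw [h, h']

theorem extend_smul {x : M} (c : ℝ) (v : TangentSpace 𝓘(ℝ, E) x) :
    ∀ᶠ y in 𝓝 x, extend E (c • v) y = (c • extend E v) y := by
  set e := trivializationAt E (TangentSpace 𝓘(ℝ, E)) x with he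
  filter_upwards [e.open_baseSet.mem_nhds (FiberBundle.mem_baseSet_trivializationAt' x)] with y hy
  have h : (e ⟨x, c • v⟩).2 = c • (e ⟨x, v⟩).2 :=
    (e.linear ℝ (FiberBundle.mem_baseSet_trivializationAt' x)).map_smul c v
  have h' := (e.symmₗ ℝ y).map_smul c (e ⟨x, v⟩).2
  rw [e.coe_symmₗ hy] at h'
  change e.symm y (e ⟨x, c • v⟩).2 = c • e.symm y (e ⟨x, v⟩).2
  rw [h, h']

variable [IsContMDiffRiemannianBundle 𝓘(ℝ, E) ∞ E (fun x : M ↦ TangentSpace 𝓘(ℝ, E) x)]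

/-- The Christoffel endomorphism `w ↦ ∇_v ∂_w` at `x`, where `∂_w = extend E w` is the vector
field that has constant coefficients in the preferred chart at `x` and value `w` at `x`. -/
def christoffel (x : M) (v : TangentSpace 𝓘(ℝ, E) x) :
    TangentSpace 𝓘(ℝ, E) x →L[ℝ] TangentSpace 𝓘(ℝ, E) x :=
  LinearMap.toContinuousLinearMap
    { toFun := fun w ↦ leviCivita E M (extend E w) x v
      map_add' := fun w w' ↦ by
        rw [(leviCivita E M).isCovariantDerivativeOnUniv.congr_of_eventuallyEq
          (mdifferentiableAt_extend ..)
          (mdifferentiableAt_add_section (mdifferentiableAt_extend ..)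
            (mdifferentiableAt_extend ..)) Filter.univ_mem (extend_add w w'),
          (leviCivita E M).isCovariantDerivativeOnUniv.add
          (mdifferentiableAt_extend ..) (mdifferentiableAt_extend ..)]
        simp
      map_smul' := fun c w ↦ by
        rw [(leviCivita E M).isCovariantDerivativeOnUniv.congr_of_eventuallyEq
          (mdifferentiableAt_extend ..)
          (mdifferentiableAt_const.smul_section (f := fun _ ↦ c) (mdifferentiableAt_extend ..))
          Filter.univ_mem (extend_smul c w)]
        change leviCivita E M (c • extend E w) x v = c • leviCivita E M (extend E w) x v
        rw [(leviCivita E M).isCovariantDerivativeOnUniv.smul_const c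
          (mdifferentiableAt_extend ..)]
        simp }

/-- The covariant derivative `∇_v α` at `x` of a form, for the Levi-Civita connection. With the
fields `∂_w` of constant coefficients in the preferred chart at `x` it is
`(∇_v α)(w₁, …, wₖ) = v(α(∂_{w₁}, …, ∂_{wₖ})) - ∑ⱼ α(w₁, …, ∇_v ∂_{wⱼ}, …, wₖ)`. -/
def covDeriv (α : FormField E M k) (x : M) (v : TangentSpace 𝓘(ℝ, E) x) :
    TangentSpace 𝓘(ℝ, E) x [⋀^Fin k]→L[ℝ] ℝ :=
  (fderiv ℝ (chartForm α x) (extChartAt 𝓘(ℝ, E) x x)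
      (mvfderiv 𝓘(ℝ, E) (extChartAt 𝓘(ℝ, E) x) x v)).compContinuousLinearMap
    (mvfderiv 𝓘(ℝ, E) (extChartAt 𝓘(ℝ, E) x) x) - endAct (christoffel x v) (α x)

/-- `α` is parallel: `∇_v α = 0` for every tangent vector `v`. -/
def IsParallel (α : FormField E M k) : Prop :=
  ∀ (x : M) (v : TangentSpace 𝓘(ℝ, E) x), covDeriv α x v = 0

/-- The codifferential `d^* α = -∑ᵢ eᵢ ⌟ ∇_{eᵢ} α`, with `(eᵢ)` an orthonormal basis of the tangent
space. -/
def codiff (α : FormField E M (k + 1)) : FormField E M k := fun x ↦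
  -∑ i, interiorProd (stdOrthonormalBasis ℝ (TangentSpace 𝓘(ℝ, E) x) i)
    (covDeriv α x (stdOrthonormalBasis ℝ (TangentSpace 𝓘(ℝ, E) x) i))

/-- `α` is coclosed, `d^* α = 0`; every `0`-form is coclosed. -/
def IsCoclosed : {k : ℕ} → FormField E M k → Prop
  | 0, _ => True
  | _ + 1, α => codiff α = 0

end Forms

section Hypersphere

variable {n : ℕ}
  {Mbar : Type*} [TopologicalSpace Mbar] [ChartedSpace (EuclideanSpace ℝ (Fin (n + 1))) Mbar]
  [IsManifold (𝓡 (n + 1)) ∞ Mbar]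
  [RiemannianBundle (fun x : Mbar ↦ TangentSpace (𝓡 (n + 1)) x)]
  [IsContMDiffRiemannianBundle (𝓡 (n + 1)) ∞ (EuclideanSpace ℝ (Fin (n + 1)))
    (fun x : Mbar ↦ TangentSpace (𝓡 (n + 1)) x)]
  {M : Type*} [EMetricSpace M] [ChartedSpace (EuclideanSpace ℝ (Fin n)) M]
  [IsManifold (𝓡 n) ∞ M]
  [RiemannianBundle (fun x : M ↦ TangentSpace (𝓡 n) x)]
  [IsContMDiffRiemannianBundle (𝓡 n) ∞ (EuclideanSpace ℝ (Fin n))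
    (fun x : M ↦ TangentSpace (𝓡 n) x)]

/-- The hypersurface `i : M → Mbar`, with the induced metric and the unit normal field `N`, is an
extrinsic hypersphere: `M` is complete and its second fundamental form
`II(X, Y) = ∇bar_X Y - ∇_X Y` equals `lam * g(X, Y) * N` for the nonzero constant `lam`. As `∇bar`
differentiates vector fields on `Mbar`, a vector field `Y` on `M` is extended locally to a vector
field `Ybar` on `Mbar`. -/
structure IsExtrinsicHypersphere (i : M → Mbar) (N : Π x : M, TangentSpace (𝓡 (n + 1)) (i x))
    (lam : ℝ) : Prop where
  complete : CompleteSpace M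
  immersion : Manifold.IsImmersion (𝓡 n) (𝓡 (n + 1)) ∞ i
  isometric : ∀ (x : M) (v w : TangentSpace (𝓡 n) x),
    ⟪mfderiv (𝓡 n) (𝓡 (n + 1)) i x v, mfderiv (𝓡 n) (𝓡 (n + 1)) i x w⟫_ℝ = ⟪v, w⟫_ℝ
  smooth_normal : ContMDiff (𝓡 n) (𝓡 (n + 1)).tangent ∞
    (fun x ↦ (⟨i x, N x⟩ : TangentBundle (𝓡 (n + 1)) Mbar))
  unit : ∀ x : M, ‖N x‖ = 1
  normal : ∀ (x : M) (v : TangentSpace (𝓡 n) x), ⟪N x, mfderiv (𝓡 n) (𝓡 (n + 1)) i x v⟫_ℝ = 0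
  lam_ne_zero : lam ≠ 0
  secondFundamentalForm_eq : ∀ (x : M) (v : TangentSpace (𝓡 n) x)
    (Y : Π y : M, TangentSpace (𝓡 n) y) (Ybar : Π z : Mbar, TangentSpace (𝓡 (n + 1)) z),
    ContMDiffAt (𝓡 n) (𝓡 n).tangent ∞ (fun y ↦ (⟨y, Y y⟩ : TangentBundle (𝓡 n) M)) x →
    ContMDiffAt (𝓡 (n + 1)) (𝓡 (n + 1)).tangent ∞
      (fun z ↦ (⟨z, Ybar z⟩ : TangentBundle (𝓡 (n + 1)) Mbar)) (i x) →
    (∀ᶠ y in 𝓝 x, Ybar (i y) = mfderiv (𝓡 n) (𝓡 (n + 1)) i y (Y y)) →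
    leviCivita (EuclideanSpace ℝ (Fin (n + 1))) Mbar Ybar (i x)
        (mfderiv (𝓡 n) (𝓡 (n + 1)) i x v)
      - mfderiv (𝓡 n) (𝓡 (n + 1)) i x (leviCivita (EuclideanSpace ℝ (Fin n)) M Y x v)
      = (lam * ⟪v, Y x⟫_ℝ) • N x

end Hypersphere

end RiemGeom

end

/-!
Let `L = di` and let `∇̄`, `∇` be the Levi-Civita connections of the ambient manifold and of the
hypersurface. Everything follows from two formulas for the tangential part `β = i^* σ` and the
normal part `γ = i^* (N ⌟ σ)` of a parallel form `σ`:

* `∇_X β = λ X^♭ ∧ γ` (`IsExtrinsicHypersphere.covDeriv_pullbackForm`),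
* `∇_X γ = -λ X ⌟ β` (`IsExtrinsicHypersphere.covDeriv_pullbackInterior`).

They are obtained by differentiating `σ(L Y₁, …, L Yₖ)` and `σ(N, L Y₁, …, L Yₚ)` along the
hypersurface, once with the Leibniz rule for `∇` and once with the Leibniz rule for `∇̄`
(`mvfderiv_form_apply`), and comparing through the Gauss formula
`∇̄_X (L Y) = L (∇_X Y) + λ ⟪X, Y⟫ N` and the Weingarten formula `∇̄_X N = -λ L X`.
Only the first of these is given; the second follows from it because the metric is parallel. The
Leibniz rule needs vector fields on the ambient manifold, so fields along the immersion are extended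
to it by means of a local smooth left inverse (`exists_extension_along`).

Antisymmetrizing the two formulas gives `dγ = -kλ β` and `dβ = 0` (`extD_apply`, which rests on the
connection being torsion-free), and contracting them gives `d^* β = -(n - k + 1) λ γ` and
`d^* γ = 0` (`sum_interiorProd_wedge`, `interiorProd_self`). The equations (i) to (iv) are these
identities substituted into one another.

If `γ` were parallel, the second formula would give `β = 0` since `λ ≠ 0`, and then the expression
for `d^* β` would give `γ = 0` since `k ≤ n`. So `σ` would vanish at the points of the hypersurface,
and a parallel form on a connected manifold that vanishes at one point vanishes identically
(`IsParallel.eq_zero_of_apply_eq_zero`): the sum of the squares of its components in an orthonormal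
frame is locally constant, because the connection matrix of such a frame is antisymmetric.
-/

set_option linter.unusedSectionVars false

noncomputable section

namespace RiemGeom

/-! ### Vector fields and forms in a chart -/

section FieldCoordinates

variable {E : Type*} [NormedAddCommGroup E] [NormedSpace ℝ E]
  {M : Type*} [TopologicalSpace M] [ChartedSpace E M] [IsManifold 𝓘(ℝ, E) ∞ M]
  {k : ℕ} {x y : M}

/-- The coordinates at `y` of the vector field `Y` in the preferred chart at `x`. -/
def fieldCoord (x : M) (Y : Π y : M, TangentSpace 𝓘(ℝ, E) y) (y : M) : E :=
  (trivializationAt E (TangentSpace 𝓘(ℝ, E)) x ⟨y, Y y⟩).2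

theorem symmL_fieldCoord (Y : Π y : M, TangentSpace 𝓘(ℝ, E) y) (hy : y ∈ (chartAt E x).source) :
    (trivializationAt E (TangentSpace 𝓘(ℝ, E)) x).symmL ℝ y (fieldCoord x Y y) = Y y := by
  have hy' : y ∈ (trivializationAt E (TangentSpace 𝓘(ℝ, E)) x).baseSet := hy
  exact (Trivialization.symmL_apply _ hy' _).trans (Trivialization.symm_apply_apply_mk _ hy' _)

/-- The derivative of the inverse chart is the inverse of the trivialization of the tangent bundle,
so `chartForm` is the form read in that trivialization. -/
theorem chartForm_eq (α : FormField E M k) {u : E} (hu : u ∈ (extChartAt 𝓘(ℝ, E) x).target) :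
    chartForm α x u = (α ((extChartAt 𝓘(ℝ, E) x).symm u)).compContinuousLinearMap
      ((trivializationAt E (TangentSpace 𝓘(ℝ, E)) x).symmL ℝ
        ((extChartAt 𝓘(ℝ, E) x).symm u)) := by
  have h : (extChartAt 𝓘(ℝ, E) x).symm u ∈ (chartAt E x).source := by
    simpa using (extChartAt 𝓘(ℝ, E) x).map_target hu
  have h1 := TangentBundle.symmL_trivializationAt (I := 𝓘(ℝ, E)) h
  rw [chartForm]
  congr 1
  rw [h1, ModelWithCorners.range_eq_univ, mfderivWithin_univ]
  rw [(extChartAt 𝓘(ℝ, E) x).right_inv hu]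

theorem chartForm_extChartAt (α : FormField E M k) (hy : y ∈ (chartAt E x).source) :
    chartForm α x (extChartAt 𝓘(ℝ, E) x y) = (α y).compContinuousLinearMap
      ((trivializationAt E (TangentSpace 𝓘(ℝ, E)) x).symmL ℝ y) := by
  rw [chartForm_eq]
  · have : (extChartAt 𝓘(ℝ, E) x).symm (extChartAt 𝓘(ℝ, E) x y) = y :=
      (extChartAt 𝓘(ℝ, E) x).left_inv (by simpa using hy)
    rw [this]
  · exact (extChartAt 𝓘(ℝ, E) x).map_source (by simpa using hy)

theorem chartForm_fieldCoord (α : FormField E M k)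
    (Y : Fin k → Π y : M, TangentSpace 𝓘(ℝ, E) y) (hy : y ∈ (chartAt E x).source) :
    chartForm α x (extChartAt 𝓘(ℝ, E) x y) (fun j ↦ fieldCoord x (Y j) y) =
      α y (fun j ↦ Y j y) := by
  rw [chartForm_extChartAt α hy]
  change α y (fun j ↦ _) = _
  exact congrArg (α y) (funext fun j ↦ symmL_fieldCoord (Y j) hy)

theorem mvfderiv_extChartAt_self :
    mvfderiv 𝓘(ℝ, E) (extChartAt 𝓘(ℝ, E) x) x =
      (trivializationAt E (TangentSpace 𝓘(ℝ, E)) x).continuousLinearMapAt ℝ x := by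
  rw [TangentBundle.continuousLinearMapAt_trivializationAt (mem_chart_source E x)]
  rfl

theorem fieldCoord_self (Y : Π y : M, TangentSpace 𝓘(ℝ, E) y) :
    fieldCoord x Y x = mvfderiv 𝓘(ℝ, E) (extChartAt 𝓘(ℝ, E) x) x (Y x) := by
  rw [mvfderiv_extChartAt_self, fieldCoord,
    Trivialization.continuousLinearMapAt_apply_of_mem]
  exact FiberBundle.mem_baseSet_trivializationAt' x

/-- `extend E w` has constant coordinates in the chart at `x`. -/
theorem fieldCoord_extend (w : TangentSpace 𝓘(ℝ, E) x) (hy : y ∈ (chartAt E x).source) :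
    fieldCoord x (extend E w) y = mvfderiv 𝓘(ℝ, E) (extChartAt 𝓘(ℝ, E) x) x w := by
  have hy' : y ∈ (trivializationAt E (TangentSpace 𝓘(ℝ, E)) x).baseSet := hy
  rw [mvfderiv_extChartAt_self, fieldCoord, extend,
    Trivialization.continuousLinearMapAt_apply_of_mem]
  · have h := congrArg Prod.snd (Trivialization.apply_mk_symm
      (trivializationAt E (TangentSpace 𝓘(ℝ, E)) x) hy'
      (trivializationAt E (TangentSpace 𝓘(ℝ, E)) x ⟨x, w⟩).2)
    exact h
  · exact FiberBundle.mem_baseSet_trivializationAt' x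

theorem mdifferentiableAt_iff_fieldCoord (Y : Π y : M, TangentSpace 𝓘(ℝ, E) y) :
    MDiffAt (T% Y) x ↔ MDiffAt (fieldCoord x Y) x :=
  mdifferentiableAt_section _ _

theorem contMDiffAt_iff_fieldCoord (Y : Π y : M, TangentSpace 𝓘(ℝ, E) y) :
    ContMDiffAt 𝓘(ℝ, E) 𝓘(ℝ, E).tangent ∞ (T% Y) x ↔
      ContMDiffAt 𝓘(ℝ, E) 𝓘(ℝ, E) ∞ (fieldCoord x Y) x :=
  contMDiffAt_section _

/-- A form is smooth if and only if its chart representations are smooth at the centres of the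
charts. -/
theorem isSmoothForm_iff (α : FormField E M k) :
    IsSmoothForm α ↔ ∀ x, ContDiffAt ℝ ∞ (chartForm α x) (extChartAt 𝓘(ℝ, E) x x) := by
  refine forall_congr' fun x ↦ ?_
  rw [contMDiffAt_section]
  have h : ∀ᶠ y in 𝓝 x, (trivializationAt (E [⋀^Fin k]→L[ℝ] ℝ)
      (fun x : M ↦ TangentSpace 𝓘(ℝ, E) x [⋀^Fin k]→L[ℝ] Bundle.Trivial M ℝ x) x ⟨y, α y⟩).2 =
      chartForm α x (extChartAt 𝓘(ℝ, E) x y) := by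
    filter_upwards [(chartAt E x).open_source.mem_nhds (mem_chart_source E x)] with y hy
    rw [chartForm_extChartAt α hy, trivializationAt_continuousAlternatingMap_apply]
    ext m
    simp [ContinuousAlternatingMap.inCoordinates, Trivial.continuousLinearMapAt_trivialization]
  rw [Filter.EventuallyEq.contMDiffAt_iff h]
  constructor
  · intro H
    have hs : ContMDiffAt 𝓘(ℝ, E) 𝓘(ℝ, E) ∞ (extChartAt 𝓘(ℝ, E) x).symm
        (extChartAt 𝓘(ℝ, E) x x) :=
      (contMDiffOn_extChartAt_symm x).contMDiffAt (extChartAt_target_mem_nhds x)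
    have hx : (extChartAt 𝓘(ℝ, E) x).symm (extChartAt 𝓘(ℝ, E) x x) = x := by simp
    rw [← contMDiffAt_iff_contDiffAt]
    refine (ContMDiffAt.comp_of_eq (y := x) H hs hx).congr_of_eventuallyEq ?_
    filter_upwards [extChartAt_target_mem_nhds (I := 𝓘(ℝ, E)) x] with u hu
    exact congrArg (chartForm α x) ((extChartAt 𝓘(ℝ, E) x).right_inv hu).symm
  · intro H
    exact H.contMDiffAt.comp x contMDiffAt_extChartAt

end FieldCoordinates

/-! ### Smooth families of alternating forms -/

section MultilinearCalculus

variable {F G : Type*} [NormedAddCommGroup F] [NormedSpace ℝ F]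
  [NormedAddCommGroup G] [NormedSpace ℝ G] {k : ℕ}

theorem contDiffAt_alternating_apply {f : G → F [⋀^Fin k]→L[ℝ] ℝ} {g : Fin k → G → F} {u : G}
    (hf : ContDiffAt ℝ ∞ f u) (hg : ∀ j, ContDiffAt ℝ ∞ (g j) u) :
    ContDiffAt ℝ ∞ (fun z ↦ f z (fun j ↦ g j z)) u := by
  -- Evaluation is precomposition with the maps `t ↦ t • g j z`, and the latter is known to be
  -- analytic jointly in the form and in the maps.
  have h1 : ContDiffAt ℝ ∞ ((fun z ↦
      ((fun j ↦ ContinuousLinearMap.toSpanSingleton ℝ (g j z)),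
        (f z).toContinuousMultilinearMap) :
        G → (Fin k → ℝ →L[ℝ] F) × ContinuousMultilinearMap ℝ (fun _ : Fin k ↦ F) ℝ)) u := by
    refine ContDiffAt.prodMk (contDiffAt_pi.2 fun j ↦ ?_) ?_
    · exact (ContinuousLinearMap.toSpanSingletonCLE (𝕜 := ℝ) (E := F)).contDiff.contDiffAt.comp u
        (hg j)
    · exact (ContinuousAlternatingMap.toContinuousMultilinearMapCLM ℝ).contDiff.contDiffAt.comp u hf
  have h2 := (ContinuousMultilinearMap.analyticOnNhd_uncurry_compContinuousLinearMap
    (𝕜 := ℝ) (Fm := fun _ : Fin k ↦ ℝ) (Em := fun _ ↦ F) (G := ℝ) (t := Set.univ)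
      _ (Set.mem_univ _)).contDiffAt (n := ∞) |>.comp u h1
  have h3 := (ContinuousMultilinearMap.apply ℝ (fun _ : Fin k ↦ ℝ) ℝ
    (fun _ ↦ 1)).contDiff.contDiffAt (n := ∞) |>.comp u h2
  refine h3.congr_of_eventuallyEq (.of_forall fun z ↦ ?_)
  simp

/-- On a finite-dimensional space, a family of alternating forms is smooth as soon as its values on
constant vectors are. -/
theorem contDiffAt_alternating_of_apply [FiniteDimensional ℝ F] {f : G → F [⋀^Fin k]→L[ℝ] ℝ} {u : G}
    (hf : ∀ m : Fin k → F, ContDiffAt ℝ ∞ (fun z ↦ f z m) u) : ContDiffAt ℝ ∞ f u := by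
  -- A form is recovered linearly from its values on the vectors of a basis.
  set b := Module.finBasis ℝ F
  let L : (F [⋀^Fin k]→L[ℝ] ℝ) →ₗ[ℝ] ((Fin k → Fin (Module.finrank ℝ F)) → ℝ) :=
    { toFun := fun α I ↦ α (fun j ↦ b (I j))
      map_add' := fun _ _ ↦ rfl
      map_smul' := fun _ _ ↦ rfl }
  have hL : LinearMap.ker L = ⊥ := by
    rw [LinearMap.ker_eq_bot']
    intro α hα
    have : α.toMultilinearMap = 0 := by
      refine Module.Basis.ext_multilinear (fun _ ↦ b) fun I ↦ ?_
      exact congrFun hα I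
    ext m
    exact congrArg (fun g : MultilinearMap ℝ (fun _ : Fin k ↦ F) ℝ ↦ g m) this
  obtain ⟨R, hR⟩ := LinearMap.exists_leftInverse_of_injective L hL
  have h1 : ContDiffAt ℝ ∞ (fun z ↦ L (f z)) u := contDiffAt_pi.2 fun I ↦ hf _
  refine (R.toContinuousLinearMap.contDiff.contDiffAt.comp u h1).congr_of_eventuallyEq
    (.of_forall fun z ↦ ?_)
  exact (LinearMap.congr_fun hR (f z)).symm

end MultilinearCalculus

/-! ### Values of smooth forms on vector fields -/

section FieldCalculus

variable {E : Type*} [NormedAddCommGroup E] [NormedSpace ℝ E]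
  {M : Type*} [TopologicalSpace M] [ChartedSpace E M] [IsManifold 𝓘(ℝ, E) ∞ M]
  {k : ℕ} {x : M}

theorem contMDiffAt_form_apply {α : FormField E M k} (hα : IsSmoothForm α)
    {Y : Fin k → Π y : M, TangentSpace 𝓘(ℝ, E) y}
    (hY : ∀ j, ContMDiffAt 𝓘(ℝ, E) 𝓘(ℝ, E).tangent ∞ (T% (Y j)) x) :
    ContMDiffAt 𝓘(ℝ, E) 𝓘(ℝ, ℝ) ∞ (fun y ↦ α y (fun j ↦ Y j y)) x := by
  have hs : ContMDiffAt 𝓘(ℝ, E) 𝓘(ℝ, E) ∞ (extChartAt 𝓘(ℝ, E) x).symm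
      (extChartAt 𝓘(ℝ, E) x x) :=
    (contMDiffOn_extChartAt_symm x).contMDiffAt (extChartAt_target_mem_nhds x)
  have hx : (extChartAt 𝓘(ℝ, E) x).symm (extChartAt 𝓘(ℝ, E) x x) = x := by simp
  have h := contDiffAt_alternating_apply ((isSmoothForm_iff α).1 hα x)
    (g := fun j u ↦ fieldCoord x (Y j) ((extChartAt 𝓘(ℝ, E) x).symm u)) fun j ↦
      contMDiffAt_iff_contDiffAt.1
        (ContMDiffAt.comp_of_eq (g := fieldCoord x (Y j)) (y := x)
          ((contMDiffAt_iff_fieldCoord (Y j)).1 (hY j)) hs hx)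
  refine (h.contMDiffAt.comp x contMDiffAt_extChartAt).congr_of_eventuallyEq ?_
  filter_upwards [(chartAt E x).open_source.mem_nhds (mem_chart_source E x)] with y hy
  rw [← chartForm_fieldCoord α Y hy]
  have h : (extChartAt 𝓘(ℝ, E) x).symm (extChartAt 𝓘(ℝ, E) x y) = y :=
    (extChartAt 𝓘(ℝ, E) x).left_inv (by simpa using hy)
  simp only [Function.comp_apply, h]

/-- Smoothness of a form can be tested at each `x` on the fields `extend E w`. -/
theorem isSmoothForm_of_apply_extend [FiniteDimensional ℝ E] {α : FormField E M k}
    (h : ∀ (x : M) (w : Fin k → TangentSpace 𝓘(ℝ, E) x),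
      ContMDiffAt 𝓘(ℝ, E) 𝓘(ℝ, ℝ) ∞ (fun y ↦ α y (fun j ↦ extend E (w j) y)) x) :
    IsSmoothForm α := by
  rw [isSmoothForm_iff]
  refine fun x ↦ contDiffAt_alternating_of_apply fun m ↦ ?_
  have hs : ContMDiffAt 𝓘(ℝ, E) 𝓘(ℝ, E) ∞ (extChartAt 𝓘(ℝ, E) x).symm
      (extChartAt 𝓘(ℝ, E) x x) :=
    (contMDiffOn_extChartAt_symm x).contMDiffAt (extChartAt_target_mem_nhds x)
  have hx : (extChartAt 𝓘(ℝ, E) x).symm (extChartAt 𝓘(ℝ, E) x x) = x := by simp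
  set e := trivializationAt E (TangentSpace 𝓘(ℝ, E)) x
  have H := ContMDiffAt.comp_of_eq (y := x) (h x fun j ↦ e.symmL ℝ x (m j)) hs hx
  rw [← contMDiffAt_iff_contDiffAt]
  refine H.congr_of_eventuallyEq ?_
  filter_upwards [extChartAt_target_mem_nhds (I := 𝓘(ℝ, E)) x] with u hu
  have hy : (extChartAt 𝓘(ℝ, E) x).symm u ∈ (chartAt E x).source := by
    simpa using (extChartAt 𝓘(ℝ, E) x).map_target hu
  rw [Function.comp_apply, ← chartForm_fieldCoord α _ hy, (extChartAt 𝓘(ℝ, E) x).right_inv hu]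
  congr 1
  funext j
  rw [fieldCoord_extend _ hy, mvfderiv_extChartAt_self]
  exact (e.continuousLinearMapAt_symmL (R := ℝ) (mem_chart_source E x) (m j)).symm

theorem mvfderiv_eq_fderiv_of_chart {F : Type*} [NormedAddCommGroup F] [NormedSpace ℝ F]
    {f : M → F} {h : E → F} (hfh : f =ᶠ[𝓝 x] h ∘ extChartAt 𝓘(ℝ, E) x)
    (hh : DifferentiableAt ℝ h (extChartAt 𝓘(ℝ, E) x x)) (v : TangentSpace 𝓘(ℝ, E) x) :
    mvfderiv 𝓘(ℝ, E) f x v = fderiv ℝ h (extChartAt 𝓘(ℝ, E) x x)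
      (mvfderiv 𝓘(ℝ, E) (extChartAt 𝓘(ℝ, E) x) x v) := by
  have h1 : HasMFDerivAt 𝓘(ℝ, E) 𝓘(ℝ, F) f x _ :=
    ((hh.hasFDerivAt.hasMFDerivAt).comp x
      (mdifferentiableAt_extChartAt (mem_chart_source E x)).hasMFDerivAt).congr_of_eventuallyEq hfh
  rw [mvfderiv, h1.mfderiv]
  rfl

end FieldCalculus

/-! ### The Leibniz rule for the covariant derivative of a form -/

section LeviCivitaCoordinates

variable {E : Type*} [NormedAddCommGroup E] [NormedSpace ℝ E] [FiniteDimensional ℝ E]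
  {M : Type*} [TopologicalSpace M] [ChartedSpace E M] [IsManifold 𝓘(ℝ, E) ∞ M]
  [RiemannianBundle (fun x : M ↦ TangentSpace 𝓘(ℝ, E) x)]
  [IsContMDiffRiemannianBundle 𝓘(ℝ, E) ∞ E (fun x : M ↦ TangentSpace 𝓘(ℝ, E) x)]
  {k : ℕ} {x : M}

theorem leviCivita_congr {Y Y' : Π y : M, TangentSpace 𝓘(ℝ, E) y} (hY : MDiffAt (T% Y) x)
    (hY' : MDiffAt (T% Y') x) (h : ∀ᶠ y in 𝓝 x, Y y = Y' y) :
    leviCivita E M Y x = leviCivita E M Y' x :=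
  (leviCivita E M).isCovariantDerivativeOnUniv.congr_of_eventuallyEq hY hY' Filter.univ_mem h

theorem leviCivita_sum {ι : Type*} (s : Finset ι) {Y : ι → Π y : M, TangentSpace 𝓘(ℝ, E) y}
    (hY : ∀ i, MDiffAt (T% (Y i)) x) :
    leviCivita E M (fun y ↦ ∑ i ∈ s, Y i y) x = ∑ i ∈ s, leviCivita E M (Y i) x := by
  classical
  induction s using Finset.induction_on with
  | empty => exact (leviCivita E M).isCovariantDerivativeOnUniv.zero (x := x)
  | insert a s ha ih =>
    rw [Finset.sum_insert ha, ← ih, ← (leviCivita E M).isCovariantDerivativeOnUniv.add (hY a)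
      (MDifferentiableAt.sum_section fun i _ ↦ hY i)]
    congr 1
    funext y
    simp [Finset.sum_insert ha]

/-- The expression of the Levi-Civita connection in a chart: Christoffel term plus the derivative of
the coordinates. -/
theorem leviCivita_eq_christoffel_add {Y : Π y : M, TangentSpace 𝓘(ℝ, E) y}
    (hY : MDiffAt (T% Y) x) (v : TangentSpace 𝓘(ℝ, E) x) :
    leviCivita E M Y x v = christoffel x v (Y x) +
      (trivializationAt E (TangentSpace 𝓘(ℝ, E)) x).symmL ℝ x
        (mvfderiv 𝓘(ℝ, E) (fieldCoord x Y) x v) := by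
  set e := trivializationAt E (TangentSpace 𝓘(ℝ, E)) x
  set b := Module.finBasis ℝ E
  have hc := (mdifferentiableAt_iff_fieldCoord Y).1 hY
  let c : Fin (Module.finrank ℝ E) → M → ℝ := fun i y ↦ b.repr (fieldCoord x Y y) i
  let B : Fin (Module.finrank ℝ E) → Π y : M, TangentSpace 𝓘(ℝ, E) y :=
    fun i ↦ extend E (e.symmL ℝ x (b i))
  have hB : ∀ i, MDiffAt (T% (B i)) x := fun i ↦ mdifferentiableAt_extend ..
  let l : Fin (Module.finrank ℝ E) → E →L[ℝ] ℝ := fun i ↦ (b.coord i).toContinuousLinearMap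
  have hcd : ∀ i, MDiffAt (c i) x := fun i ↦ by
    exact (l i).differentiableAt.mdifferentiableAt.comp x hc
  have hcv : ∀ i, mvfderiv 𝓘(ℝ, E) (c i) x v = l i (mvfderiv 𝓘(ℝ, E) (fieldCoord x Y) x v) := by
    intro i
    have h := ((l i).hasFDerivAt.hasMFDerivAt).comp x hc.hasMFDerivAt
    have h' : HasMFDerivAt 𝓘(ℝ, E) 𝓘(ℝ, ℝ) (c i) x _ := h
    rw [mvfderiv, h'.mfderiv]
    rfl
  have hBx : ∀ᶠ y in 𝓝 x, Y y = ∑ i, (c i • B i) y := by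
    filter_upwards [(chartAt E x).open_source.mem_nhds (mem_chart_source E x)] with y hy
    have h1 : ∀ i, B i y = e.symmL ℝ y (b i) := fun i ↦ by
      rw [← symmL_fieldCoord (B i) hy, fieldCoord_extend _ hy, mvfderiv_extChartAt_self]
      exact congrArg _ (e.continuousLinearMapAt_symmL (R := ℝ) (mem_chart_source E x) (b i))
    have h2 : ∀ i, (c i • B i) y = c i y • e.symmL ℝ y (b i) := fun i ↦ by
      rw [← h1]; rfl
    rw [Finset.sum_congr rfl fun i _ ↦ h2 i]
    have h3 := congrArg (e.symmL ℝ y) (b.sum_repr (fieldCoord x Y y))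
    rw [map_sum] at h3
    simp only [map_smul] at h3
    exact (h3.trans (symmL_fieldCoord Y hy)).symm
  have hcB : ∀ i, MDiffAt (T% (c i • B i)) x := fun i ↦ (hcd i).smul_section (hB i)
  rw [leviCivita_congr hY (MDifferentiableAt.sum_section fun i _ ↦ hcB i) hBx,
    leviCivita_sum _ hcB, hBx.self_of_nhds, map_sum]
  have h4 := congrArg (e.symmL ℝ x) (b.sum_repr (mvfderiv 𝓘(ℝ, E) (fieldCoord x Y) x v))
  rw [map_sum] at h4
  rw [← h4, sum_apply, ← Finset.sum_add_distrib]
  refine Finset.sum_congr rfl fun i _ ↦ ?_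
  rw [(leviCivita E M).isCovariantDerivativeOnUniv.leibniz (hB i) (hcd i)]
  have hBi : B i x = e.symmL ℝ x (b i) := extend_apply_self ..
  have h5 : (c i • B i) x = c i x • e.symmL ℝ x (b i) := by rw [← hBi]; rfl
  rw [h5, map_smul, map_smul, add_apply, smul_apply, ContinuousLinearMap.smulRight_apply,
    hcv, hBi]
  rfl

/-- A smooth form evaluated on differentiable fields is differentiable, and its derivative is given
by the Leibniz rule. In the chart at `x` this is the product rule for alternating maps, corrected by
the Christoffel terms of `leviCivita_eq_christoffel_add`. -/
theorem mdifferentiableAt_form_apply_and_mvfderiv {α : FormField E M k} (hα : IsSmoothForm α)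
    {Y : Fin k → Π y : M, TangentSpace 𝓘(ℝ, E) y} (hY : ∀ j, MDiffAt (T% (Y j)) x) :
    MDiffAt (fun y ↦ α y (fun j ↦ Y j y)) x ∧ ∀ v : TangentSpace 𝓘(ℝ, E) x,
      mvfderiv 𝓘(ℝ, E) (fun y ↦ α y (fun j ↦ Y j y)) x v =
        covDeriv α x v (fun j ↦ Y j x) +
          ∑ j, α x (Function.update (fun j ↦ Y j x) j (leviCivita E M (Y j) x v)) := by
  have hx : (extChartAt 𝓘(ℝ, E) x).symm (extChartAt 𝓘(ℝ, E) x x) = x := by simp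
  have hs : MDifferentiableAt 𝓘(ℝ, E) 𝓘(ℝ, E) (extChartAt 𝓘(ℝ, E) x).symm
      (extChartAt 𝓘(ℝ, E) x x) :=
    ((contMDiffOn_extChartAt_symm x).contMDiffAt (extChartAt_target_mem_nhds x)).mdifferentiableAt
      (n := ∞) (by simp)
  let c : Fin k → E → E := fun j u ↦ fieldCoord x (Y j) ((extChartAt 𝓘(ℝ, E) x).symm u)
  have hcd : ∀ j, DifferentiableAt ℝ (c j) (extChartAt 𝓘(ℝ, E) x x) := fun j ↦
    mdifferentiableAt_iff_differentiableAt.1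
      (MDifferentiableAt.comp_of_eq (g := fieldCoord x (Y j)) (y := x) _
        ((mdifferentiableAt_iff_fieldCoord (Y j)).1 (hY j)) hs hx)
  have hev : ∀ᶠ y in 𝓝 x, (extChartAt 𝓘(ℝ, E) x).symm (extChartAt 𝓘(ℝ, E) x y) = y := by
    filter_upwards [(chartAt E x).open_source.mem_nhds (mem_chart_source E x)] with y hy
    exact (extChartAt 𝓘(ℝ, E) x).left_inv (by simpa using hy)
  have hcv : ∀ j v, fderiv ℝ (c j) (extChartAt 𝓘(ℝ, E) x x)
      (mvfderiv 𝓘(ℝ, E) (extChartAt 𝓘(ℝ, E) x) x v) =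
        mvfderiv 𝓘(ℝ, E) (fieldCoord x (Y j)) x v := fun j v ↦ by
    refine (mvfderiv_eq_fderiv_of_chart ?_ (hcd j) v).symm
    filter_upwards [hev] with y hy
    simp only [c, Function.comp_apply, hy]
  have hαd : DifferentiableAt ℝ (chartForm α x) (extChartAt 𝓘(ℝ, E) x x) :=
    ((isSmoothForm_iff α).1 hα x).differentiableAt (by simp)
  have hF := hαd.hasFDerivAt.continuousAlternatingMap_apply fun j ↦ (hcd j).hasFDerivAt
  have hEq : (fun y ↦ α y (fun j ↦ Y j y)) =ᶠ[𝓝 x]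
      (fun u ↦ chartForm α x u (fun j ↦ c j u)) ∘ extChartAt 𝓘(ℝ, E) x := by
    filter_upwards [(chartAt E x).open_source.mem_nhds (mem_chart_source E x), hev] with y hy hy'
    rw [← chartForm_fieldCoord α Y hy]
    simp only [c, Function.comp_apply, hy']
  refine ⟨((hF.differentiableAt.mdifferentiableAt).comp x
    (mdifferentiableAt_extChartAt (mem_chart_source E x))).congr_of_eventuallyEq hEq, fun v ↦ ?_⟩
  rw [mvfderiv_eq_fderiv_of_chart hEq hF.differentiableAt, hF.fderiv]
  have hc0 : ∀ j, c j (extChartAt 𝓘(ℝ, E) x x) =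
      mvfderiv 𝓘(ℝ, E) (extChartAt 𝓘(ℝ, E) x) x (Y j x) := fun j ↦ by
    rw [← fieldCoord_self]
    simp only [c, hx]
  have key : ∀ j, chartForm α x (extChartAt 𝓘(ℝ, E) x x)
      (Function.update (fun j ↦ c j (extChartAt 𝓘(ℝ, E) x x)) j
        (mvfderiv 𝓘(ℝ, E) (fieldCoord x (Y j)) x v)) =
      α x (Function.update (fun j ↦ Y j x) j (leviCivita E M (Y j) x v)) -
        α x (Function.update (fun j ↦ Y j x) j (christoffel x v (Y j x))) := by
    intro j
    rw [leviCivita_eq_christoffel_add (hY j), α x |>.map_update_add, add_sub_cancel_left,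
      chartForm_extChartAt α (mem_chart_source E x)]
    change α x _ = _
    congr 1
    funext l
    by_cases h : l = j
    · subst h
      simp
    · rw [Function.update_of_ne h, Function.update_of_ne h, hc0, ← fieldCoord_self]
      exact symmL_fieldCoord (Y l) (mem_chart_source E x)
  change fderiv ℝ (chartForm α x) (extChartAt 𝓘(ℝ, E) x x)
      (mvfderiv 𝓘(ℝ, E) (extChartAt 𝓘(ℝ, E) x) x v) (fun j ↦ c j (extChartAt 𝓘(ℝ, E) x x)) +
    (∑ j, _ : E →L[ℝ] ℝ) (mvfderiv 𝓘(ℝ, E) (extChartAt 𝓘(ℝ, E) x) x v) = _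
  rw [sum_apply]
  refine (congrArg₂ (· + ·) rfl (Finset.sum_congr rfl fun j _ ↦ (congrArg (fun z ↦
    chartForm α x (extChartAt 𝓘(ℝ, E) x x)
      (Function.update (fun j ↦ c j (extChartAt 𝓘(ℝ, E) x x)) j z))
        (hcv j v)).trans (key j))).trans ?_
  rw [Finset.sum_sub_distrib]
  have hcov : covDeriv α x v (fun j ↦ Y j x) =
      fderiv ℝ (chartForm α x) (extChartAt 𝓘(ℝ, E) x x)
        (mvfderiv 𝓘(ℝ, E) (extChartAt 𝓘(ℝ, E) x) x v)
          (fun j ↦ mvfderiv 𝓘(ℝ, E) (extChartAt 𝓘(ℝ, E) x) x (Y j x)) -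
      ∑ j, α x (Function.update (fun j ↦ Y j x) j (christoffel x v (Y j x))) := rfl
  rw [hcov]
  simp only [hc0]
  ring

theorem mdifferentiableAt_form_apply {α : FormField E M k} (hα : IsSmoothForm α)
    {Y : Fin k → Π y : M, TangentSpace 𝓘(ℝ, E) y} (hY : ∀ j, MDiffAt (T% (Y j)) x) :
    MDiffAt (fun y ↦ α y (fun j ↦ Y j y)) x :=
  (mdifferentiableAt_form_apply_and_mvfderiv hα hY).1

/-- The Leibniz rule that characterises `∇α`, for arbitrary differentiable vector fields. -/
theorem mvfderiv_form_apply {α : FormField E M k} (hα : IsSmoothForm α)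
    {Y : Fin k → Π y : M, TangentSpace 𝓘(ℝ, E) y} (hY : ∀ j, MDiffAt (T% (Y j)) x)
    (v : TangentSpace 𝓘(ℝ, E) x) :
    mvfderiv 𝓘(ℝ, E) (fun y ↦ α y (fun j ↦ Y j y)) x v =
      covDeriv α x v (fun j ↦ Y j x) +
        ∑ j, α x (Function.update (fun j ↦ Y j x) j (leviCivita E M (Y j) x v)) :=
  (mdifferentiableAt_form_apply_and_mvfderiv hα hY).2 v

end LeviCivitaCoordinates

/-! ### Algebra of alternating forms -/

section AlternatingAlgebra

variable {V : Type*} [AddCommGroup V] [Module ℝ V] [TopologicalSpace V] {k : ℕ}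

/-- Moving the `j`-th argument to the front costs the sign `(-1) ^ j`. -/
theorem alternating_update (α : V [⋀^Fin (k + 1)]→L[ℝ] ℝ) (m : Fin (k + 1) → V) (j : Fin (k + 1))
    (z : V) : α (Function.update m j z) = (-1) ^ (j : ℕ) * interiorProd z α (j.removeNth m) := by
  rw [← Fin.insertNth_removeNth]
  simpa [interiorProd_apply] using α.toAlternatingMap.map_insertNth j z (j.removeNth m)

/-- A symmetric bilinear map acts on alternating forms with zero antisymmetrization. This is the
algebra behind `d = ∑ eᵢ ∧ ∇_{eᵢ}` for a torsion-free connection. -/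
theorem sum_endAct_eq_zero_of_symm (A : V → V →L[ℝ] V) (hA : ∀ v w, A v w = A w v)
    (hadd : ∀ v v' w, A (v + v') w = A v w + A v' w)
    (hsmul : ∀ (c : ℝ) v w, A (c • v) w = c • A v w) (α : V [⋀^Fin k]→L[ℝ] ℝ)
    (m : Fin (k + 1) → V) :
    ∑ i : Fin (k + 1), (-1 : ℝ) ^ (i : ℕ) * endAct (A (m i)) α (i.removeNth m) = 0 := by
  let Γ : V →ₗ[ℝ] V →ₗ[ℝ] V := LinearMap.mk₂ ℝ (fun v w ↦ A v w) hadd hsmul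
    (fun v ↦ map_add (A v)) (fun c v ↦ map_smul (A v) c)
  cases k with
  | zero =>
    refine Finset.sum_eq_zero fun i _ ↦ ?_
    refine mul_eq_zero_of_right _ ?_
    change ∑ j : Fin 0, α (Function.update (i.removeNth m) j (A (m i) (i.removeNth m j))) = 0
    simp
  | succ k =>
    have h := AlternatingMap.alternatizeUncurryFin_alternatizeUncurryFinLM_comp_of_symmetric
      (f := Γ.compr₂ (AlternatingMap.curryLeft α.toAlternatingMap)) fun v w ↦ by simp [Γ, hA v w]
    have h' := congrArg (fun g : V [⋀^Fin (k + 2)]→ₗ[ℝ] ℝ ↦ g m) h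
    simp only [AlternatingMap.alternatizeUncurryFin_apply] at h'
    refine Eq.trans (Finset.sum_congr rfl fun i _ ↦ ?_) h'
    rw [zsmul_eq_mul]
    push_cast
    congr 1
    change _ = AlternatingMap.alternatizeUncurryFin
      (Γ.compr₂ (AlternatingMap.curryLeft α.toAlternatingMap) (m i)) (i.removeNth m)
    have h1 : endAct (A (m i)) α (i.removeNth m) =
      ∑ j, α (Function.update (i.removeNth m) j (A (m i) (i.removeNth m j))) := rfl
    rw [h1, AlternatingMap.alternatizeUncurryFin_apply]
    refine Finset.sum_congr rfl fun j _ ↦ ?_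
    rw [alternating_update, zsmul_eq_mul]
    simp [interiorProd_apply, Γ]

theorem sum_interiorProd_removeNth (α : V [⋀^Fin (k + 1)]→L[ℝ] ℝ) (m : Fin (k + 1) → V) :
    ∑ j : Fin (k + 1), (-1 : ℝ) ^ (j : ℕ) * interiorProd (m j) α (j.removeNth m) =
      (k + 1) * α m := by
  simp only [← alternating_update, Function.update_eq_self]
  simp

theorem interiorProd_self (v : V) (α : V [⋀^Fin (k + 2)]→L[ℝ] ℝ) :
    interiorProd v (interiorProd v α) = 0 := by
  ext m
  exact α.map_eq_zero_of_eq _ (i := 0) (j := 1) rfl (by simp)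

theorem eq_zero_of_interiorProd {α : V [⋀^Fin (k + 1)]→L[ℝ] ℝ} (h : ∀ v, interiorProd v α = 0) :
    α = 0 := by
  ext m
  have := alternating_update α m 0 (m 0)
  rw [Function.update_eq_self, h] at this
  simpa using this

theorem wedge_smul_right (l : V →L[ℝ] ℝ) (c : ℝ) (α : V [⋀^Fin k]→L[ℝ] ℝ) :
    wedge l (c • α) = c • wedge l α := by
  ext m
  rw [ContinuousAlternatingMap.smul_apply, wedge_apply, wedge_apply, smul_eq_mul, Finset.mul_sum]
  refine Finset.sum_congr rfl fun j _ ↦ ?_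
  rw [ContinuousAlternatingMap.smul_apply, smul_eq_mul]
  ring

/-- For a symmetric bilinear form `B`, with `vᵢ^♭ = B vᵢ`, antisymmetrizing `v ↦ v^♭ ∧ α` gives
zero: `∑ᵢ (-1)ⁱ (vᵢ^♭ ∧ α)(v₀, …, v̂ᵢ, …) = 0`. -/
theorem sum_wedge_removeNth (B : V → V →L[ℝ] ℝ) (hB : ∀ v w, B v w = B w v)
    (hadd : ∀ v w, B (v + w) = B v + B w) (hsmul : ∀ (c : ℝ) v, B (c • v) = c • B v)
    (α : V [⋀^Fin k]→L[ℝ] ℝ) (m : Fin (k + 2) → V) :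
    ∑ i : Fin (k + 2), (-1 : ℝ) ^ (i : ℕ) * wedge (B (m i)) α (i.removeNth m) = 0 := by
  let f : V →ₗ[ℝ] V →ₗ[ℝ] V [⋀^Fin k]→ₗ[ℝ] ℝ :=
    LinearMap.mk₂ ℝ (fun v w ↦ B v w • α.toAlternatingMap)
      (fun v v' w ↦ by simp [hadd, add_smul]) (fun c v w ↦ by simp [hsmul, mul_smul])
      (fun v w w' ↦ by simp [add_smul]) (fun c v w ↦ by simp [mul_smul])
  have h := AlternatingMap.alternatizeUncurryFin_alternatizeUncurryFinLM_comp_of_symmetric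
    (f := f) fun v w ↦ by simp [f, hB v w]
  have h' := congrArg (fun g : V [⋀^Fin (k + 2)]→ₗ[ℝ] ℝ ↦ g m) h
  simp only [AlternatingMap.alternatizeUncurryFin_apply] at h'
  refine Eq.trans (Finset.sum_congr rfl fun i _ ↦ ?_) h'
  rw [zsmul_eq_mul]
  push_cast
  congr 1

/-- An alternating form that is annihilated by `v` only sees the components transverse to `v`. -/
theorem alternating_add_smul_of_interiorProd_eq_zero {v : V} {α : V [⋀^Fin k]→L[ℝ] ℝ}
    (h : ∀ (m : Fin k → V) j, α (Function.update m j v) = 0) (m : Fin k → V) (t : Fin k → ℝ) :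
    α (fun j ↦ m j + t j • v) = α m := by
  classical
  have h1 := α.toAlternatingMap.toMultilinearMap.map_add_univ m (fun j ↦ t j • v)
  refine h1.trans ?_
  rw [Finset.sum_eq_single Finset.univ]
  · exact congrArg α (Finset.piecewise_univ ..)
  · intro s _ hs
    obtain ⟨j, hj⟩ : ∃ j, j ∉ s := by
      by_contra! H
      exact hs (Finset.eq_univ_iff_forall.2 H)
    have h2 : s.piecewise m (fun j ↦ t j • v) =
        Function.update (s.piecewise m (fun j ↦ t j • v)) j (t j • v) := by
      rw [eq_comm, Function.update_eq_self_iff, Finset.piecewise_eq_of_notMem _ _ _ hj]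
    rw [h2]
    refine (α.map_update_smul _ j (t j) v).trans ?_
    rw [h, smul_zero]
  · simp

end AlternatingAlgebra

section InnerAlgebra

variable {V : Type*} [NormedAddCommGroup V] [InnerProductSpace ℝ V] {k : ℕ}

/-- `∑ᵢ eᵢ ⌟ (eᵢ^♭ ∧ α) = (n - k) α` for a `k`-form `α` in dimension `n`. -/
theorem sum_interiorProd_wedge {ι : Type*} [Fintype ι] (e : OrthonormalBasis ι ℝ V)
    (α : V [⋀^Fin k]→L[ℝ] ℝ) :
    ∑ i, interiorProd (e i) (wedge (innerSL ℝ (e i)) α) = ((Fintype.card ι : ℝ) - k) • α := by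
  ext m
  have h1 : ∀ i, interiorProd (e i) (wedge (innerSL ℝ (e i)) α) m =
      α m - ∑ j, ⟪e i, m j⟫_ℝ * α (Function.update m j (e i)) := by
    intro i
    rw [interiorProd_apply, wedge_apply, Fin.sum_univ_succ]
    have h0 : Fin.removeNth 0 (Matrix.vecCons (e i) m) = m := rfl
    rw [h0, sub_eq_add_neg, ← Finset.sum_neg_distrib]
    congr 1
    · simp
    · refine Finset.sum_congr rfl fun j _ ↦ ?_
      cases k with
      | zero => exact j.elim0
      | succ k =>
        have h2 : j.succ.removeNth (Matrix.vecCons (e i) m) =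
            Matrix.vecCons (e i) (j.removeNth m) := by
          funext l
          refine Fin.cases ?_ (fun l ↦ ?_) l <;> simp [Fin.removeNth]
        rw [alternating_update, interiorProd_apply, h2]
        simp only [Matrix.cons_val_succ, Fin.val_succ, pow_succ, innerSL_apply_apply]
        ring
  have h3 : ∀ j, ∑ i, ⟪e i, m j⟫_ℝ * α (Function.update m j (e i)) = α m := by
    intro j
    have h4 := e.sum_repr' (m j)
    have h5 : α (Function.update m j (m j)) = α m := by rw [Function.update_eq_self]
    rw [← h5]
    conv_rhs => rw [← h4]
    have h6 : ∀ s : Finset ι, ∀ g : ι → V,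
        α (Function.update m j (∑ i ∈ s, g i)) = ∑ i ∈ s, α (Function.update m j (g i)) :=
      fun s g ↦ α.toAlternatingMap.toMultilinearMap.map_update_sum s j g m
    rw [h6]
    refine Finset.sum_congr rfl fun i _ ↦ ?_
    rw [α.map_update_smul, smul_eq_mul]
  rw [ContinuousAlternatingMap.sum_apply]
  simp only [h1]
  rw [Finset.sum_sub_distrib, Finset.sum_comm, Finset.sum_congr rfl fun j _ ↦ h3 j]
  simp
  ring

end InnerAlgebra

/-! ### Exterior and covariant derivative -/

section ExteriorDerivative

variable {E : Type*} [NormedAddCommGroup E] [NormedSpace ℝ E] [FiniteDimensional ℝ E]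
  {M : Type*} [TopologicalSpace M] [ChartedSpace E M] [IsManifold 𝓘(ℝ, E) ∞ M]
  {k : ℕ} {x : M}

/-- The fields `extend E v` and `extend E w` have constant coordinates in the same chart, so they
commute at `x`. -/
theorem mlieBracket_extend (v w : TangentSpace 𝓘(ℝ, E) x) :
    mlieBracket 𝓘(ℝ, E) (extend E v) (extend E w) x = 0 := by
  have key : ∀ w : TangentSpace 𝓘(ℝ, E) x, ∀ᶠ u in 𝓝 (extChartAt 𝓘(ℝ, E) x x),
      mpullbackWithin 𝓘(ℝ, E) 𝓘(ℝ, E) (extChartAt 𝓘(ℝ, E) x).symm (extend E w)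
        (Set.range 𝓘(ℝ, E)) u = mvfderiv 𝓘(ℝ, E) (extChartAt 𝓘(ℝ, E) x) x w := by
    intro w
    filter_upwards [extChartAt_target_mem_nhds (I := 𝓘(ℝ, E)) x] with u hu
    have hy : (extChartAt 𝓘(ℝ, E) x).symm u ∈ (chartAt E x).source := by
      simpa using (extChartAt 𝓘(ℝ, E) x).map_target hu
    have h1 := TangentBundle.symmL_trivializationAt (I := 𝓘(ℝ, E)) hy
    rw [(extChartAt 𝓘(ℝ, E) x).right_inv hu] at h1
    have h2 := symmL_fieldCoord (extend E w) hy
    rw [fieldCoord_extend w hy, h1] at h2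
    rw [mpullbackWithin_apply, ← h2]
    exact (isInvertible_mfderivWithin_extChartAt_symm hu).inverse_apply_self _
  rw [← mlieBracketWithin_univ, mlieBracketWithin_apply]
  simp only [Set.preimage_univ, Set.univ_inter, ModelWithCorners.range_eq_univ] at key ⊢
  have h0 : ∀ (V W : E → E) (a b : E), V =ᶠ[𝓝 (extChartAt 𝓘(ℝ, E) x x)] (fun _ ↦ a) →
      W =ᶠ[𝓝 (extChartAt 𝓘(ℝ, E) x x)] (fun _ ↦ b) →
      lieBracketWithin ℝ V W Set.univ (extChartAt 𝓘(ℝ, E) x x) = 0 := by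
    intro V W a b hV hW
    rw [lieBracketWithin_univ, lieBracket, hV.fderiv_eq, hW.fderiv_eq]
    simp
  exact (congrArg _ (h0 _ _ _ _ (key v) (key w))).trans (map_zero _)

variable
  [RiemannianBundle (fun x : M ↦ TangentSpace 𝓘(ℝ, E) x)]
  [IsContMDiffRiemannianBundle 𝓘(ℝ, E) ∞ E (fun x : M ↦ TangentSpace 𝓘(ℝ, E) x)]

/-- The Levi-Civita connection is torsion-free, and coordinate fields commute. -/
theorem christoffel_symm (v w : TangentSpace 𝓘(ℝ, E) x) :
    christoffel x v w = christoffel x w v := by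
  have h := (CovariantDerivative.torsion_eq_zero_iff _).1 (leviCivita_torsion (E := E) (M := M))
    (X := extend E v) (Y := extend E w) (x := x) (mdifferentiableAt_extend ..)
    (mdifferentiableAt_extend ..)
  rw [mlieBracket_extend, extend_apply_self, extend_apply_self, sub_eq_zero] at h
  exact h

theorem christoffel_add_left (v v' w : TangentSpace 𝓘(ℝ, E) x) :
    christoffel x (v + v') w = christoffel x v w + christoffel x v' w :=
  (leviCivita E M (extend E w) x).map_add v v'

theorem christoffel_smul_left (c : ℝ) (v w : TangentSpace 𝓘(ℝ, E) x) :
    christoffel x (c • v) w = c • christoffel x v w :=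
  (leviCivita E M (extend E w) x).map_smul c v

/-- The exterior derivative is the antisymmetrization of the covariant derivative: the Christoffel
terms cancel by symmetry. -/
theorem extD_apply (α : FormField E M k) (m : Fin (k + 1) → TangentSpace 𝓘(ℝ, E) x) :
    extD α x m = ∑ i : Fin (k + 1), (-1 : ℝ) ^ (i : ℕ) * covDeriv α x (m i) (i.removeNth m) := by
  have h := sum_endAct_eq_zero_of_symm (christoffel x) christoffel_symm christoffel_add_left
    christoffel_smul_left (α x) m
  rw [← add_zero (∑ i : Fin (k + 1), _), ← h, ← Finset.sum_add_distrib]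
  change ContinuousAlternatingMap.alternatizeUncurryFin _ _ = _
  rw [ContinuousAlternatingMap.alternatizeUncurryFin_apply]
  refine Finset.sum_congr rfl fun i _ ↦ ?_
  rw [covDeriv, ContinuousAlternatingMap.sub_apply, ← mul_add, sub_add_cancel, zsmul_eq_mul]
  push_cast
  rfl

end ExteriorDerivative

/-! ### Functions with vanishing derivative -/

section LocallyConstant

variable {E : Type*} [NormedAddCommGroup E] [NormedSpace ℝ E]
  {M : Type*} [TopologicalSpace M] [ChartedSpace E M] [IsManifold 𝓘(ℝ, E) ∞ M] {x : M}

theorem mdifferentiableAt_sum_and_mvfderiv {ι : Type*} (s : Finset ι) {f : ι → M → ℝ}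
    (hf : ∀ i, MDiffAt (f i) x) (v : TangentSpace 𝓘(ℝ, E) x) :
    MDiffAt (fun y ↦ ∑ i ∈ s, f i y) x ∧
      mvfderiv 𝓘(ℝ, E) (fun y ↦ ∑ i ∈ s, f i y) x v = ∑ i ∈ s, mvfderiv 𝓘(ℝ, E) (f i) x v := by
  classical
  induction s using Finset.induction_on with
  | empty => exact ⟨mdifferentiableAt_const, by simp [mvfderiv_const]⟩
  | insert a s ha ih =>
    simp only [Finset.sum_insert ha]
    refine ⟨(hf a).add ih.1, ?_⟩
    rw [mvfderiv_fun_add (hf a) ih.1, add_apply, ih.2]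

theorem eventually_eq_of_mvfderiv_eq_zero {f : M → ℝ} {U : Set M} (hU : U ∈ 𝓝 x)
    (hf : ∀ y ∈ U, MDiffAt f y) (hf' : ∀ y ∈ U, mvfderiv 𝓘(ℝ, E) f y = 0) :
    ∀ᶠ y in 𝓝 x, f y = f x := by
  set φ := extChartAt 𝓘(ℝ, E) x
  have hx : φ.symm (φ x) = x := by simp [φ]
  have hcont : ContinuousAt φ.symm (φ x) := continuousAt_extChartAt_symm x
  have hV : φ.target ∩ φ.symm ⁻¹' U ∈ 𝓝 (φ x) :=
    Filter.inter_mem (extChartAt_target_mem_nhds x) (hcont (by rwa [hx]))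
  obtain ⟨r, hr, hball⟩ := Metric.mem_nhds_iff.1 hV
  have hder : ∀ u ∈ Metric.ball (φ x) r, HasFDerivAt (f ∘ φ.symm) (0 : E →L[ℝ] ℝ) u := by
    intro u hu
    have hs : MDifferentiableAt 𝓘(ℝ, E) 𝓘(ℝ, E) φ.symm u :=
      ((contMDiffOn_extChartAt_symm x).contMDiffAt
        ((isOpen_extChartAt_target x).mem_nhds (hball hu).1)).mdifferentiableAt (n := ∞) (by simp)
    have h1 : HasMFDerivAt 𝓘(ℝ, E) 𝓘(ℝ, ℝ) f (φ.symm u) 0 := by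
      have h2 := (hf _ (hball hu).2).hasMFDerivAt
      have h3 : mfderiv 𝓘(ℝ, E) 𝓘(ℝ, ℝ) f (φ.symm u) = 0 := hf' _ (hball hu).2
      rwa [h3] at h2
    have h4 := h1.comp u hs.hasMFDerivAt
    rw [ContinuousLinearMap.zero_comp] at h4
    exact h4.hasFDerivAt
  have hconst : ∀ u ∈ Metric.ball (φ x) r, (f ∘ φ.symm) u = (f ∘ φ.symm) (φ x) := fun u hu ↦
    Metric.isOpen_ball.is_const_of_fderiv_eq_zero (convex_ball _ _).isPreconnected
      (fun u hu ↦ (hder u hu).differentiableAt.differentiableWithinAt)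
      (fun u hu ↦ (hder u hu).fderiv) hu (Metric.mem_ball_self hr)
  filter_upwards [(chartAt E x).open_source.mem_nhds (mem_chart_source E x),
    (continuousAt_extChartAt (I := 𝓘(ℝ, E)) x) (Metric.ball_mem_nhds (φ x) hr)] with y hy hy'
  have h : f (φ.symm (φ y)) = f (φ.symm (φ x)) := hconst (φ y) hy'
  have h5 : φ.symm (φ y) = y := φ.left_inv (by simpa [φ] using hy)
  rwa [h5, hx] at h

end LocallyConstant

/-! ### Zeros of parallel forms -/

section OrthonormalFrame

variable {E : Type*} [NormedAddCommGroup E] [NormedSpace ℝ E] [FiniteDimensional ℝ E]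
  {M : Type*} [TopologicalSpace M] [ChartedSpace E M] [IsManifold 𝓘(ℝ, E) ∞ M]
  [RiemannianBundle (fun x : M ↦ TangentSpace 𝓘(ℝ, E) x)]
  [IsContMDiffRiemannianBundle 𝓘(ℝ, E) ∞ E (fun x : M ↦ TangentSpace 𝓘(ℝ, E) x)]
  {k : ℕ} {x : M}

open InnerProductSpace in
/-- The Gram-Schmidt process preserves differentiability of frames. -/
theorem mdifferentiableAt_gramSchmidt {d : ℕ} {s : Fin d → Π y : M, TangentSpace 𝓘(ℝ, E) y}
    (hs : ∀ i, MDiffAt (T% (s i)) x) (hli : ∀ᶠ y in 𝓝 x, LinearIndependent ℝ (fun i ↦ s i y))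
    (i : Fin d) :
    MDiffAt (T% (fun y ↦ gramSchmidt ℝ (fun i ↦ s i y) i)) x := by
  induction i using WellFoundedLT.induction with
  | _ i ih =>
  let g : Fin d → Π y : M, TangentSpace 𝓘(ℝ, E) y := fun i y ↦ gramSchmidt ℝ (fun i ↦ s i y) i
  have hc : ∀ j ∈ Finset.Iio i,
      MDiffAt ((fun y ↦ ⟪g j y, s i y⟫_ℝ) / fun y ↦ ⟪g j y, g j y⟫_ℝ) x := by
    intro j hj
    have hgj : MDiffAt (T% (g j)) x := ih j (Finset.mem_Iio.1 hj)
    exact (mdifferentiableAt_inner hgj (hs i)).div (mdifferentiableAt_inner hgj hgj)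
      (inner_self_ne_zero.2 (gramSchmidt_ne_zero j hli.self_of_nhds))
  have hsum := MDifferentiableAt.sum_section (I := 𝓘(ℝ, E)) (F := E) fun j hj ↦
    (hc j hj).smul_section (ih j (Finset.mem_Iio.1 hj))
  have h := mdifferentiableAt_sub_section (hs i) hsum
  refine h.congr_of_eventuallyEq (.of_forall fun y ↦ ?_)
  refine congrArg (TotalSpace.mk y) ?_
  refine (eq_sub_of_add_eq (gramSchmidt_def'' ℝ (fun i ↦ s i y) i).symm).trans ?_
  refine congrArg (s i y - ·) (Finset.sum_congr rfl fun j _ ↦ ?_)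
  have h2 := real_inner_self_eq_norm_sq (g j y)
  change (⟪g j y, s i y⟫_ℝ / ‖g j y‖ ^ 2) • g j y = (⟪g j y, s i y⟫_ℝ / ⟪g j y, g j y⟫_ℝ) • g j y
  rw [h2]

open InnerProductSpace in
/-- Every point has a neighbourhood with a differentiable orthonormal frame, obtained by the
Gram-Schmidt process. -/
theorem exists_orthonormal_frame (x : M) :
    ∃ U ∈ 𝓝 x, IsOpen U ∧ ∃ e : Fin (Module.finrank ℝ E) → Π y : M, TangentSpace 𝓘(ℝ, E) y,
      ∀ y ∈ U, Orthonormal ℝ (fun i ↦ e i y) ∧ ∀ i, MDiffAt (T% (e i)) y := by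
  set tr := trivializationAt E (TangentSpace 𝓘(ℝ, E)) x
  set b := Module.finBasis ℝ E
  have hframe := tr.isLocalFrameOn_localFrame_baseSet 𝓘(ℝ, E) ∞ b
  refine ⟨tr.baseSet, tr.open_baseSet.mem_nhds (FiberBundle.mem_baseSet_trivializationAt' x),
    tr.open_baseSet, fun i y ↦ gramSchmidtNormed ℝ (fun i ↦ tr.localFrame b i y) i, fun y hy ↦ ?_⟩
  have hli := hframe.linearIndependent hy
  refine ⟨gramSchmidtNormed_orthonormal hli, fun i ↦ ?_⟩
  have hgs := mdifferentiableAt_gramSchmidt (x := y) (s := tr.localFrame b)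
    (fun i ↦ (hframe.contMDiffAt tr.open_baseSet hy i).mdifferentiableAt (by simp))
    (by filter_upwards [tr.open_baseSet.mem_nhds hy] with z hz using hframe.linearIndependent hz) i
  have hne : ⟪gramSchmidt ℝ (fun i ↦ tr.localFrame b i y) i,
      gramSchmidt ℝ (fun i ↦ tr.localFrame b i y) i⟫_ℝ ≠ 0 :=
    inner_self_ne_zero.2 (gramSchmidt_ne_zero i hli)
  have h2 : DifferentiableAt ℝ (fun r : ℝ ↦ (Real.sqrt r)⁻¹)
      ⟪gramSchmidt ℝ (fun i ↦ tr.localFrame b i y) i,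
        gramSchmidt ℝ (fun i ↦ tr.localFrame b i y) i⟫_ℝ :=
    (differentiableAt_id.sqrt hne).inv
      (Real.sqrt_ne_zero'.2 (lt_of_le_of_ne real_inner_self_nonneg hne.symm))
  have hn := h2.mdifferentiableAt.comp y (mdifferentiableAt_inner hgs hgs)
  refine (hn.smul_section hgs).congr_of_eventuallyEq (.of_forall fun z ↦ ?_)
  congr 1

/-- Antisymmetry of the connection matrix `a` kills the derivative of the sum of squares of the
components `f I`: exchanging `I j` with the summation index `l` changes the sign of each term. -/
theorem sum_antisymm_eq_zero {ι : Type*} [Fintype ι] {a : ι → ι → ℝ}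
    (ha : ∀ i j, a i j = -a j i) (f : (Fin k → ι) → ℝ) (j : Fin k) :
    ∑ I : Fin k → ι, ∑ l, f I * (a (I j) l * f (Function.update I j l)) = 0 := by
  rw [← Fintype.sum_prod_type']
  have h : ∑ p : (Fin k → ι) × ι, f p.1 * (a (p.1 j) p.2 * f (Function.update p.1 j p.2)) =
      ∑ p : (Fin k → ι) × ι, -(f p.1 * (a (p.1 j) p.2 * f (Function.update p.1 j p.2))) := by
    let φ : (Fin k → ι) × ι → (Fin k → ι) × ι := fun p ↦ (Function.update p.1 j p.2, p.1 j)
    have hφ : Function.Involutive φ := fun p ↦ by simp [φ]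
    refine Fintype.sum_equiv hφ.toPerm _ _ fun p ↦ ?_
    simp only [Function.Involutive.coe_toPerm, φ, Function.update_self, Function.update_idem,
      Function.update_eq_self]
    rw [ha]
    ring
  rw [Finset.sum_neg_distrib] at h
  linarith

/-- The connection matrix of an orthonormal frame is antisymmetric. -/
theorem inner_leviCivita_orthonormal {ι : Type*} {e : ι → Π y : M, TangentSpace 𝓘(ℝ, E) y}
    (he : ∀ i, MDiffAt (T% (e i)) x) (ho : ∀ᶠ y in 𝓝 x, Orthonormal ℝ (fun i ↦ e i y))
    (v : TangentSpace 𝓘(ℝ, E) x) (i j : ι) :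
    ⟪leviCivita E M (e i) x v, e j x⟫_ℝ = -⟪leviCivita E M (e j) x v, e i x⟫_ℝ := by
  classical
  have h := leviCivita_metric (X := extend E v) (mdifferentiableAt_extend ..) (he i) (he j)
  rw [extend_apply_self] at h
  have hc : (fun y ↦ ⟪e i y, e j y⟫_ℝ) =ᶠ[𝓝 x] fun _ ↦ if i = j then (1 : ℝ) else 0 := by
    filter_upwards [ho] with y hy
    exact orthonormal_iff_ite.1 hy i j
  have h0 : mvfderiv 𝓘(ℝ, E) (fun y ↦ ⟪e i y, e j y⟫_ℝ) x v = 0 := by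
    rw [mvfderiv, hc.mfderiv_eq]
    rw [mfderiv_const]
    rfl
  rw [h0] at h
  linarith [real_inner_comm (e i x) (leviCivita E M (e j) x v)]

/-- Whether a parallel form vanishes is locally constant: near each point, the sum of the squares of
its components in an orthonormal frame has derivative zero. -/
theorem IsParallel.eventually_eq_zero_iff {σ : FormField E M k} (hσ : IsSmoothForm σ)
    (hpar : IsParallel σ) (x : M) : ∀ᶠ y in 𝓝 x, (σ y = 0 ↔ σ x = 0) := by
  obtain ⟨U, hU, hUo, e, he⟩ := exists_orthonormal_frame (E := E) x
  let f : (Fin k → Fin (Module.finrank ℝ E)) → M → ℝ := fun I y ↦ σ y (fun j ↦ e (I j) y)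
  let h : M → ℝ := fun y ↦ ∑ I, f I y * f I y
  have hd : ∀ y ∈ U, ∀ I, MDiffAt (f I) y := fun y hy I ↦
    mdifferentiableAt_form_apply hσ fun j ↦ (he y hy).2 (I j)
  have hfr : ∀ y : M, Module.finrank ℝ (TangentSpace 𝓘(ℝ, E) y) = Module.finrank ℝ E := fun y ↦ rfl
  have hzero : ∀ y ∈ U, (σ y = 0 ↔ h y = 0) := by
    intro y hy
    constructor
    · intro h0
      simp [h, f, h0]
    · intro h0
      have h1 : ∀ I, f I y = 0 := fun I ↦ by
        have := (Finset.sum_eq_zero_iff_of_nonneg (fun I _ ↦ mul_self_nonneg (f I y))).1 h0 I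
          (Finset.mem_univ I)
        exact mul_self_eq_zero.1 this
      have hli := (he y hy).1.linearIndependent
      let B := basisOfLinearIndependentOfCardEqFinrank' _ hli
        ((Fintype.card_fin _).trans (hfr y).symm)
      have : (σ y).toMultilinearMap = 0 := by
        refine Module.Basis.ext_multilinear (fun _ ↦ B) fun I ↦ ?_
        simpa [B, f] using! h1 I
      ext m
      exact congrArg (fun g : MultilinearMap ℝ (fun _ : Fin k ↦ TangentSpace 𝓘(ℝ, E) y) ℝ ↦ g m)
        this
  have hder : ∀ y ∈ U, MDiffAt h y ∧ mvfderiv 𝓘(ℝ, E) h y = 0 := by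
    intro y hy
    have hff : ∀ I, MDiffAt (fun z ↦ f I z * f I z) y := fun I ↦ (hd y hy I).mul (hd y hy I)
    refine ⟨(mdifferentiableAt_sum_and_mvfderiv Finset.univ hff 0).1, ?_⟩
    ext v
    rw [(mdifferentiableAt_sum_and_mvfderiv Finset.univ hff v).2]
    let a : Fin (Module.finrank ℝ E) → Fin (Module.finrank ℝ E) → ℝ := fun i l ↦
      ⟪leviCivita E M (e i) y v, e l y⟫_ℝ
    have ha : ∀ i l, a i l = -a l i := fun i l ↦
      inner_leviCivita_orthonormal (he y hy).2
        (by filter_upwards [hUo.mem_nhds hy] with z hz using (he z hz).1) v i l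
    let B := basisOfLinearIndependentOfCardEqFinrank' _ (he y hy).1.linearIndependent
        ((Fintype.card_fin _).trans (hfr y).symm)
    let OB := B.toOrthonormalBasis (by simpa [B] using! (he y hy).1)
    have hOB : ∀ i, OB i = e i y := fun i ↦ by simp [OB, B]
    have hexp : ∀ i, leviCivita E M (e i) y v = ∑ l, a i l • e l y := fun i ↦ by
      conv_lhs => rw [← OB.sum_repr' (leviCivita E M (e i) y v)]
      refine Finset.sum_congr rfl fun l _ ↦ ?_
      rw [hOB, real_inner_comm]
    have hfd : ∀ I, mvfderiv 𝓘(ℝ, E) (f I) y v =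
        ∑ j, ∑ l, a (I j) l * f (Function.update I j l) y := by
      intro I
      rw [mvfderiv_form_apply hσ fun j ↦ (he y hy).2 (I j), hpar y v]
      refine (zero_add _).trans ?_
      refine Finset.sum_congr rfl fun j _ ↦ ?_
      rw [hexp]
      refine ((σ y).toAlternatingMap.toMultilinearMap.map_update_sum Finset.univ j
        (fun l ↦ a (I j) l • e l y) _).trans (Finset.sum_congr rfl fun l _ ↦ ?_)
      refine ((σ y).map_update_smul _ j (a (I j) l) (e l y)).trans ?_
      rw [smul_eq_mul]
      congr 2
      funext i
      by_cases hij : i = j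
      · subst hij; simp
      · simp [hij]
    have : ∀ I, mvfderiv 𝓘(ℝ, E) (fun z ↦ f I z * f I z) y v =
        2 * ∑ j, ∑ l, f I y * (a (I j) l * f (Function.update I j l) y) := by
      intro I
      rw [mvfderiv_fun_mul (hd y hy I) (hd y hy I), add_apply, smul_apply, hfd, smul_eq_mul,
        ← two_mul]
      simp only [Finset.mul_sum]
    rw [Finset.sum_congr rfl fun I _ ↦ this I, ← Finset.mul_sum, Finset.sum_comm]
    simp [sum_antisymm_eq_zero ha (fun I ↦ f I y)]
  filter_upwards [eventually_eq_of_mvfderiv_eq_zero hU (fun y hy ↦ (hder y hy).1)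
    (fun y hy ↦ (hder y hy).2), hU] with y hy hyU
  rw [hzero y hyU, hzero x (mem_of_mem_nhds hU), hy]

/-- A parallel form on a connected manifold that vanishes at a point vanishes identically. -/
theorem IsParallel.eq_zero_of_apply_eq_zero [PreconnectedSpace M] {σ : FormField E M k}
    (hσ : IsSmoothForm σ) (hpar : IsParallel σ) (hx : σ x = 0) : σ = 0 := by
  have hopen : IsOpen {y | σ y = 0} := isOpen_iff_mem_nhds.2 fun y hy ↦ by
    filter_upwards [hpar.eventually_eq_zero_iff hσ y] with z hz using hz.2 hy
  have hclosed : IsClosed {y | σ y = 0} := by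
    rw [← isOpen_compl_iff]
    refine isOpen_iff_mem_nhds.2 fun y hy ↦ ?_
    filter_upwards [hpar.eventually_eq_zero_iff hσ y] with z hz using fun h ↦ hy (hz.1 h)
  have huniv := IsClopen.eq_univ ⟨hclosed, hopen⟩ ⟨x, hx⟩
  funext y
  exact huniv.ge (Set.mem_univ y)

end OrthonormalFrame

/-! ### Vector fields along an immersion -/

section Immersions

variable {E : Type*} [NormedAddCommGroup E] [NormedSpace ℝ E]
  {M : Type*} [TopologicalSpace M] [ChartedSpace E M] [IsManifold 𝓘(ℝ, E) ∞ M]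
  {F : Type*} [NormedAddCommGroup F] [NormedSpace ℝ F]
  {P : Type*} [TopologicalSpace P] [ChartedSpace F P] [IsManifold 𝓘(ℝ, F) ∞ P]
  {f : M → P} {x : M}

/-- In adapted charts an immersion is `u ↦ (u, 0)`, and the first projection inverts it. -/
theorem exists_smooth_leftInverse (hf : Manifold.IsImmersionAt 𝓘(ℝ, E) 𝓘(ℝ, F) ∞ f x) :
    ∃ r : P → M, ContMDiffAt 𝓘(ℝ, F) 𝓘(ℝ, E) ∞ r (f x) ∧ ∀ᶠ y in 𝓝 x, r (f y) = y := by
  let φ := hf.domChart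
  let ψ := hf.codChart
  have key : ∀ y ∈ φ.source, (hf.equiv.symm (ψ (f y))).1 = φ y := by
    intro y hy
    have hmem : φ y ∈ (φ.extend 𝓘(ℝ, E)).target := by simpa using φ.map_source hy
    have h1 : ψ (f (φ.symm (φ y))) = hf.equiv (φ y, 0) := hf.writtenInCharts hmem
    rw [φ.left_inv hy] at h1
    rw [h1, ContinuousLinearEquiv.symm_apply_apply]
  refine ⟨fun z ↦ φ.symm (hf.equiv.symm (ψ z)).1, ?_, ?_⟩
  · have h1 : ContMDiffAt 𝓘(ℝ, F) 𝓘(ℝ, F) ∞ ψ (f x) :=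
      contMDiffAt_of_mem_maximalAtlas hf.codChart_mem_maximalAtlas hf.mem_codChart_source
    have h2 : ContMDiffAt 𝓘(ℝ, F) 𝓘(ℝ, E) ∞ (fun u ↦ (hf.equiv.symm u).1) (ψ (f x)) :=
      (contDiff_fst.comp hf.equiv.symm.contDiff).contDiffAt.contMDiffAt
    have h3 : ContMDiffAt 𝓘(ℝ, E) 𝓘(ℝ, E) ∞ φ.symm (φ x) :=
      contMDiffAt_symm_of_mem_maximalAtlas hf.domChart_mem_maximalAtlas
        (φ.map_source hf.mem_domChart_source)
    exact ContMDiffAt.comp_of_eq (g := φ.symm) (y := φ x) h3 (h2.comp (f x) h1)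
      (key x hf.mem_domChart_source)
  · filter_upwards [φ.open_source.mem_nhds hf.mem_domChart_source] with y hy
    rw [key y hy, φ.left_inv hy]

/-- A smooth vector field along an immersion is locally the restriction of a vector field on the
target. -/
theorem exists_extension_along (hf : Manifold.IsImmersionAt 𝓘(ℝ, E) 𝓘(ℝ, F) ∞ f x)
    {V : Π y : M, TangentSpace 𝓘(ℝ, F) (f y)}
    (hV : ContMDiffAt 𝓘(ℝ, E) 𝓘(ℝ, F).tangent ∞
      (fun y ↦ (⟨f y, V y⟩ : TangentBundle 𝓘(ℝ, F) P)) x) :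
    ∃ W : Π z : P, TangentSpace 𝓘(ℝ, F) z,
      ContMDiffAt 𝓘(ℝ, F) 𝓘(ℝ, F).tangent ∞ (T% W) (f x) ∧ ∀ᶠ y in 𝓝 x, W (f y) = V y := by
  obtain ⟨r, hr, hrf⟩ := exists_smooth_leftInverse hf
  set e := trivializationAt F (TangentSpace 𝓘(ℝ, F)) (f x)
  have hbase : e.baseSet ∈ 𝓝 (f x) :=
    e.open_baseSet.mem_nhds (FiberBundle.mem_baseSet_trivializationAt' (f x))
  let c : M → F := fun y ↦ (e ⟨f y, V y⟩).2
  have hc : ContMDiffAt 𝓘(ℝ, E) 𝓘(ℝ, F) ∞ c x := (contMDiffAt_totalSpace.1 hV).2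
  -- The coordinates of `W` at `z` are those of `V` at the point `r z` of the source.
  refine ⟨fun z ↦ e.symm z (c (r z)), (contMDiffAt_iff_fieldCoord _).2 ?_, ?_⟩
  · refine (ContMDiffAt.comp_of_eq (g := c) (y := x) hc hr
      hrf.self_of_nhds).congr_of_eventuallyEq ?_
    filter_upwards [hbase] with z hz
    have h := congrArg Prod.snd (e.apply_mk_symm hz (c (r z)))
    exact h
  · filter_upwards [hrf, hf.contMDiffAt.continuousAt hbase] with y hy hy'
    rw [hy]
    exact e.symm_apply_apply_mk hy' (V y)

theorem contMDiffAt_pushforward (hf : ContMDiff 𝓘(ℝ, E) 𝓘(ℝ, F) ∞ f)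
    {Y : Π y : M, TangentSpace 𝓘(ℝ, E) y}
    (hY : ContMDiffAt 𝓘(ℝ, E) 𝓘(ℝ, E).tangent ∞ (T% Y) x) :
    ContMDiffAt 𝓘(ℝ, E) 𝓘(ℝ, F).tangent ∞
      (fun y ↦ (⟨f y, mfderiv 𝓘(ℝ, E) 𝓘(ℝ, F) f y (Y y)⟩ : TangentBundle 𝓘(ℝ, F) P)) x :=
  ((hf.contMDiff_tangentMap (m := ∞) (by simp)).contMDiffAt).comp x hY

theorem mvfderiv_comp_eq_of_eventuallyEq {h : P → ℝ} {h' : M → ℝ}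
    (hf : MDifferentiableAt 𝓘(ℝ, E) 𝓘(ℝ, F) f x)
    (hh : MDifferentiableAt 𝓘(ℝ, F) 𝓘(ℝ, ℝ) h (f x)) (heq : ∀ᶠ y in 𝓝 x, h' y = h (f y))
    (v : TangentSpace 𝓘(ℝ, E) x) :
    mvfderiv 𝓘(ℝ, F) h (f x) (mfderiv 𝓘(ℝ, E) 𝓘(ℝ, F) f x v) = mvfderiv 𝓘(ℝ, E) h' x v := by
  have h1 : HasMFDerivAt 𝓘(ℝ, E) 𝓘(ℝ, ℝ) h' x _ :=
    (hh.hasMFDerivAt.comp x hf.hasMFDerivAt).congr_of_eventuallyEq heq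
  rw [mvfderiv, mvfderiv, h1.mfderiv]
  rfl

end Immersions

/-! ### Normal decomposition -/

section Hyperplanes

variable {V W : Type*} [NormedAddCommGroup V] [InnerProductSpace ℝ V] [FiniteDimensional ℝ V]
  [NormedAddCommGroup W] [InnerProductSpace ℝ W] [FiniteDimensional ℝ W]

/-- An isometric hyperplane and its unit normal span: by counting dimensions, `(v, t) ↦ L v + t • N`
is surjective because it is injective. -/
theorem exists_eq_add_smul_normal {L : V →L[ℝ] W} {N : W}
    (hL : ∀ v w, ⟪L v, L w⟫_ℝ = ⟪v, w⟫_ℝ) (hN : ‖N‖ = 1) (hLN : ∀ v, ⟪N, L v⟫_ℝ = 0)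
    (hdim : Module.finrank ℝ W = Module.finrank ℝ V + 1) (u : W) :
    ∃ (v : V) (t : ℝ), u = L v + t • N := by
  let Φ : V × ℝ →ₗ[ℝ] W :=
    L.toLinearMap.coprod (LinearMap.toSpanSingleton ℝ W N)
  have hΦ : ∀ v t, Φ (v, t) = L v + t • N := fun v t ↦ by simp [Φ]
  have hNN : ⟪N, N⟫_ℝ = 1 := by rw [real_inner_self_eq_norm_sq, hN, one_pow]
  have hinj : Function.Injective Φ := by
    rw [injective_iff_map_eq_zero]
    rintro ⟨v, t⟩ h
    rw [hΦ] at h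
    have ht : t = 0 := by
      have := congrArg (fun z ↦ ⟪N, z⟫_ℝ) h
      rwa [inner_add_right, inner_smul_right, hLN, hNN, zero_add, mul_one, inner_zero_right] at this
    have hv : ⟪v, v⟫_ℝ = 0 := by
      have := congrArg (fun z ↦ ⟪L v, z⟫_ℝ) h
      rwa [ht, zero_smul, add_zero, hL, inner_zero_right] at this
    rw [inner_self_eq_zero.1 hv, ht]
    rfl
  have hsurj := (LinearMap.injective_iff_surjective_of_finrank_eq_finrank (by simp [hdim])).1 hinj
  obtain ⟨⟨v, t⟩, h⟩ := hsurj u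
  exact ⟨v, t, by rw [← h, hΦ]⟩

end Hyperplanes

/-! ### The tangential and normal parts of a parallel form -/

section Hypersphere

variable {n : ℕ}
  {Mbar : Type*} [TopologicalSpace Mbar] [ChartedSpace (EuclideanSpace ℝ (Fin (n + 1))) Mbar]
  [IsManifold (𝓡 (n + 1)) ∞ Mbar]
  [RiemannianBundle (fun x : Mbar ↦ TangentSpace (𝓡 (n + 1)) x)]
  [IsContMDiffRiemannianBundle (𝓡 (n + 1)) ∞ (EuclideanSpace ℝ (Fin (n + 1)))
    (fun x : Mbar ↦ TangentSpace (𝓡 (n + 1)) x)]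
  {M : Type*} [EMetricSpace M] [ChartedSpace (EuclideanSpace ℝ (Fin n)) M]
  [IsManifold (𝓡 n) ∞ M]
  [RiemannianBundle (fun x : M ↦ TangentSpace (𝓡 n) x)]
  [IsContMDiffRiemannianBundle (𝓡 n) ∞ (EuclideanSpace ℝ (Fin n))
    (fun x : M ↦ TangentSpace (𝓡 n) x)]
  {i : M → Mbar} {N : Π x : M, TangentSpace (𝓡 (n + 1)) (i x)} {lam : ℝ} {p : ℕ}
  {σ : FormField (EuclideanSpace ℝ (Fin (n + 1))) Mbar (p + 1)}

namespace IsExtrinsicHypersphere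

theorem contMDiff (hM : IsExtrinsicHypersphere i N lam) : ContMDiff (𝓡 n) (𝓡 (n + 1)) ∞ i :=
  hM.immersion.contMDiff

theorem mdifferentiableAt (hM : IsExtrinsicHypersphere i N lam) (x : M) :
    MDifferentiableAt (𝓡 n) (𝓡 (n + 1)) i x :=
  hM.contMDiff.contMDiffAt.mdifferentiableAt (by simp)

theorem exists_extension_normal (hM : IsExtrinsicHypersphere i N lam) (x : M) :
    ∃ W : Π z : Mbar, TangentSpace (𝓡 (n + 1)) z,
      ContMDiffAt (𝓡 (n + 1)) (𝓡 (n + 1)).tangent ∞ (T% W) (i x) ∧ ∀ᶠ y in 𝓝 x, W (i y) = N y :=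
  exists_extension_along (hM.immersion.isImmersionAt x) hM.smooth_normal.contMDiffAt

theorem exists_extension_tangent (hM : IsExtrinsicHypersphere i N lam) {x : M}
    (w : TangentSpace (𝓡 n) x) :
    ∃ W : Π z : Mbar, TangentSpace (𝓡 (n + 1)) z,
      ContMDiffAt (𝓡 (n + 1)) (𝓡 (n + 1)).tangent ∞ (T% W) (i x) ∧
        ∀ᶠ y in 𝓝 x, W (i y) =
          mfderiv (𝓡 n) (𝓡 (n + 1)) i y (extend (EuclideanSpace ℝ (Fin n)) w y) :=
  exists_extension_along (hM.immersion.isImmersionAt x)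
    (contMDiffAt_pushforward hM.contMDiff (contMDiffAt_extend ..))

theorem exists_eq_add_smul_normal (hM : IsExtrinsicHypersphere i N lam) (x : M)
    (u : TangentSpace (𝓡 (n + 1)) (i x)) : ∃ (v : TangentSpace (𝓡 n) x) (t : ℝ),
      u = mfderiv (𝓡 n) (𝓡 (n + 1)) i x v + t • N x := by
  refine RiemGeom.exists_eq_add_smul_normal (hM.isometric x) (hM.unit x) (hM.normal x) ?_ u
  change Module.finrank ℝ (EuclideanSpace ℝ (Fin (n + 1))) =
    Module.finrank ℝ (EuclideanSpace ℝ (Fin n)) + 1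
  simp

/-- The Gauss formula `∇̄_v W = ∇_v w + λ ⟪v, w⟫ N`, for the field `extend _ w` on the hypersurface
and an extension `W` of its image. -/
theorem gauss_formula (hM : IsExtrinsicHypersphere i N lam) {x : M} (v w : TangentSpace (𝓡 n) x)
    {W : Π z : Mbar, TangentSpace (𝓡 (n + 1)) z}
    (hW : ContMDiffAt (𝓡 (n + 1)) (𝓡 (n + 1)).tangent ∞ (T% W) (i x))
    (hWi : ∀ᶠ y in 𝓝 x, W (i y) =
      mfderiv (𝓡 n) (𝓡 (n + 1)) i y (extend (EuclideanSpace ℝ (Fin n)) w y)) :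
    leviCivita (EuclideanSpace ℝ (Fin (n + 1))) Mbar W (i x) (mfderiv (𝓡 n) (𝓡 (n + 1)) i x v) =
      mfderiv (𝓡 n) (𝓡 (n + 1)) i x
        (leviCivita (EuclideanSpace ℝ (Fin n)) M (extend (EuclideanSpace ℝ (Fin n)) w) x v) +
      (lam * ⟪v, w⟫_ℝ) • N x := by
  have h := hM.secondFundamentalForm_eq x v (extend (EuclideanSpace ℝ (Fin n)) w) W
    (contMDiffAt_extend ..) hW hWi
  rw [extend_apply_self] at h
  exact (sub_eq_iff_eq_add'.1 h)

/-- The Weingarten formula `∇̄_v N = -λ v`, for an extension `W` of the unit normal. It follows from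
differentiating `⟪N, N⟫ = 1` and `⟪N, Z⟫ = 0` for tangent fields `Z`. -/
theorem weingarten_formula (hM : IsExtrinsicHypersphere i N lam) {x : M} (v : TangentSpace (𝓡 n) x)
    {W : Π z : Mbar, TangentSpace (𝓡 (n + 1)) z}
    (hW : ContMDiffAt (𝓡 (n + 1)) (𝓡 (n + 1)).tangent ∞ (T% W) (i x))
    (hWi : ∀ᶠ y in 𝓝 x, W (i y) = N y) :
    leviCivita (EuclideanSpace ℝ (Fin (n + 1))) Mbar W (i x) (mfderiv (𝓡 n) (𝓡 (n + 1)) i x v) =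
      (-lam) • mfderiv (𝓡 n) (𝓡 (n + 1)) i x v := by
  have hWd : MDifferentiableAt (𝓡 (n + 1)) (𝓡 (n + 1)).tangent (T% W) (i x) :=
    hW.mdifferentiableAt (by simp)
  have hWx : W (i x) = N x := hWi.self_of_nhds
  have hconst : ∀ (Z : Π z : Mbar, TangentSpace (𝓡 (n + 1)) z) (c : ℝ),
      MDifferentiableAt (𝓡 (n + 1)) (𝓡 (n + 1)).tangent (T% Z) (i x) →
      (∀ᶠ y in 𝓝 x, c = ⟪W (i y), Z (i y)⟫_ℝ) →
      ⟪leviCivita (EuclideanSpace ℝ (Fin (n + 1))) Mbar W (i x)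
          (mfderiv (𝓡 n) (𝓡 (n + 1)) i x v), Z (i x)⟫_ℝ +
        ⟪W (i x), leviCivita (EuclideanSpace ℝ (Fin (n + 1))) Mbar Z (i x)
          (mfderiv (𝓡 n) (𝓡 (n + 1)) i x v)⟫_ℝ = 0 := by
    intro Z c hZ hc
    have h1 := leviCivita_metric (X := extend (EuclideanSpace ℝ (Fin (n + 1)))
      (mfderiv (𝓡 n) (𝓡 (n + 1)) i x v)) (mdifferentiableAt_extend ..) hWd hZ
    rw [extend_apply_self] at h1
    have h2 := mvfderiv_comp_eq_of_eventuallyEq (h' := fun _ ↦ c) (hM.mdifferentiableAt x)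
      (mdifferentiableAt_inner hWd hZ) hc v
    rw [← h1]
    refine h2.trans ?_
    rw [mvfderiv_const]
    rfl
  set u := leviCivita (EuclideanSpace ℝ (Fin (n + 1))) Mbar W (i x)
    (mfderiv (𝓡 n) (𝓡 (n + 1)) i x v)
  have hNN : ∀ y, ⟪N y, N y⟫_ℝ = 1 := fun y ↦ by
    rw [real_inner_self_eq_norm_sq, hM.unit, one_pow]
  have hN : ⟪u, N x⟫_ℝ = 0 := by
    have h := hconst W 1 hWd (by filter_upwards [hWi] with y hy using by rw [hy, hNN])
    rw [hWx, real_inner_comm] at h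
    rw [real_inner_comm]
    linarith
  have hT : ∀ w, ⟪u, mfderiv (𝓡 n) (𝓡 (n + 1)) i x w⟫_ℝ = -(lam * ⟪v, w⟫_ℝ) := by
    intro w
    obtain ⟨Z, hZ, hZi⟩ := hM.exists_extension_tangent w
    have h := hconst Z 0 (hZ.mdifferentiableAt (by simp)) (by
      filter_upwards [hWi, hZi] with y hy hy'
      rw [hy, hy', hM.normal])
    have hZx := hZi.self_of_nhds
    rw [extend_apply_self] at hZx
    rw [hM.gauss_formula v w hZ hZi, hWx, hZx, inner_add_right, hM.normal, inner_smul_right,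
      hNN] at h
    linarith
  refine ext_inner_right ℝ fun z ↦ ?_
  obtain ⟨w, t, rfl⟩ := hM.exists_eq_add_smul_normal x z
  rw [inner_add_right, inner_add_right, inner_smul_right, inner_smul_right, hN, hT,
    inner_smul_left, inner_smul_left, hM.isometric,
    real_inner_comm (N x) (mfderiv (𝓡 n) (𝓡 (n + 1)) i x v), hM.normal]
  simp

theorem isSmoothForm_pullbackForm (hM : IsExtrinsicHypersphere i N lam) (hσ : IsSmoothForm σ) :
    IsSmoothForm (E := EuclideanSpace ℝ (Fin n)) (pullbackForm i σ) := by
  refine isSmoothForm_of_apply_extend fun x w ↦ ?_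
  choose W hW hWi using fun j ↦ hM.exists_extension_tangent (w j)
  refine ((contMDiffAt_form_apply hσ hW).comp x hM.contMDiff.contMDiffAt).congr_of_eventuallyEq ?_
  filter_upwards [Filter.eventually_all.2 hWi] with y hy
  exact congrArg (σ (i y)) (funext fun j ↦ (hy j).symm)

theorem isSmoothForm_pullbackInterior (hM : IsExtrinsicHypersphere i N lam) (hσ : IsSmoothForm σ) :
    IsSmoothForm (E := EuclideanSpace ℝ (Fin n)) (pullbackInterior i N σ) := by
  refine isSmoothForm_of_apply_extend fun x w ↦ ?_
  choose W hW hWi using fun j ↦ hM.exists_extension_tangent (w j)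
  obtain ⟨W₀, hW₀, hW₀i⟩ := hM.exists_extension_normal x
  have hcons : ∀ j : Fin (p + 1), ContMDiffAt (𝓡 (n + 1)) (𝓡 (n + 1)).tangent ∞
      (T% ((Fin.cons W₀ W : Fin (p + 1) → Π z : Mbar, TangentSpace (𝓡 (n + 1)) z) j)) (i x) :=
    Fin.cases hW₀ hW
  refine ((contMDiffAt_form_apply hσ hcons).comp x
    hM.contMDiff.contMDiffAt).congr_of_eventuallyEq ?_
  filter_upwards [Filter.eventually_all.2 hWi, hW₀i] with y hy hy'
  refine congrArg (σ (i y)) (funext fun j ↦ ?_)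
  refine Fin.cases ?_ (fun j ↦ ?_) j
  · exact hy'.symm
  · exact (hy j).symm

/-- The covariant derivative of the pullback of a parallel form: replacing `L wⱼ` by its ambient
derivative produces `∇_v wⱼ`, accounted for by `∇`, and the terms `λ ⟪v, wⱼ⟫ N`, which add up to the
exterior product. -/
theorem covDeriv_pullbackForm (hM : IsExtrinsicHypersphere i N lam) (hσ : IsSmoothForm σ)
    (hpar : IsParallel σ) (x : M) (v : TangentSpace (𝓡 n) x) :
    covDeriv (pullbackForm i σ) x v = lam • wedge (flat v) (pullbackInterior i N σ x) := by
  ext w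
  choose W hW hWi using fun j ↦ hM.exists_extension_tangent (w j)
  have hWd : ∀ j, MDifferentiableAt (𝓡 (n + 1)) (𝓡 (n + 1)).tangent (T% (W j)) (i x) :=
    fun j ↦ (hW j).mdifferentiableAt (by simp)
  have hWx : ∀ j, W j (i x) = mfderiv (𝓡 n) (𝓡 (n + 1)) i x (w j) := fun j ↦ by
    have h := (hWi j).self_of_nhds
    rwa [extend_apply_self] at h
  set L := mfderiv (𝓡 n) (𝓡 (n + 1)) i x
  have h1 := mvfderiv_form_apply (hM.isSmoothForm_pullbackForm hσ)
    (Y := fun j ↦ extend (EuclideanSpace ℝ (Fin n)) (w j)) (x := x)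
    (fun j ↦ mdifferentiableAt_extend ..) v
  have h2 := mvfderiv_form_apply hσ hWd (L v)
  have h3 := mvfderiv_comp_eq_of_eventuallyEq (hM.mdifferentiableAt x)
    (mdifferentiableAt_form_apply hσ hWd) (h' := fun y ↦ pullbackForm i σ y
      (fun j ↦ extend (EuclideanSpace ℝ (Fin n)) (w j) y)) (by
        filter_upwards [Filter.eventually_all.2 hWi] with y hy
        exact congrArg (σ (i y)) (funext fun j ↦ (hy j).symm)) v
  have h4 := h1.symm.trans (h3.symm.trans h2)
  have h5 : (fun j ↦ extend (EuclideanSpace ℝ (Fin n)) (w j) x) = w := by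
    funext j; exact extend_apply_self ..
  rw [hpar (i x) (L v), h5] at h4
  have h6 : ∀ j, σ (i x) (Function.update (fun j ↦ W j (i x)) j
      (leviCivita (EuclideanSpace ℝ (Fin (n + 1))) Mbar (W j) (i x) (L v))) =
      pullbackForm i σ x (Function.update w j (leviCivita (EuclideanSpace ℝ (Fin n)) M
        (extend (EuclideanSpace ℝ (Fin n)) (w j)) x v)) +
      lam * ((-1) ^ (j : ℕ) * (flat v (w j) * pullbackInterior i N σ x (j.removeNth w))) := by
    intro j
    rw [hM.gauss_formula v (w j) (hW j) (hWi j), (σ (i x)).map_update_add,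
      (σ (i x)).map_update_smul, alternating_update _ _ _ (N x), funext hWx]
    have h7 : Function.update (fun j ↦ L (w j)) j (L (leviCivita (EuclideanSpace ℝ (Fin n)) M
        (extend (EuclideanSpace ℝ (Fin n)) (w j)) x v)) = fun l ↦ L (Function.update w j
        (leviCivita (EuclideanSpace ℝ (Fin n)) M
          (extend (EuclideanSpace ℝ (Fin n)) (w j)) x v) l) := by
      funext l
      exact (Function.apply_update (fun _ ↦ L) w j _ l).symm
    rw [h7]
    have h8 : pullbackInterior i N σ x (j.removeNth w) =
      interiorProd (N x) (σ (i x)) (j.removeNth fun j ↦ L (w j)) := rfl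
    have h9 : flat v (w j) = ⟪v, w j⟫_ℝ := rfl
    rw [h8, h9, smul_eq_mul]
    have h10 : ∀ m, pullbackForm i σ x m = σ (i x) (fun l ↦ L (m l)) := fun _ ↦ rfl
    rw [h10]
    ring
  rw [Finset.sum_congr rfl fun j _ ↦ h6 j, Finset.sum_add_distrib, ← Finset.mul_sum] at h4
  have h11 : (lam • wedge (flat v) (pullbackInterior i N σ x)) w =
      lam * wedge (flat v) (pullbackInterior i N σ x) w := rfl
  have h12 : (0 : TangentSpace (𝓡 (n + 1)) (i x) [⋀^Fin (p + 1)]→L[ℝ] ℝ)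
      (fun j ↦ W j (i x)) = 0 := rfl
  rw [h11, wedge_apply]
  rw [h12] at h4
  linarith

/-- The covariant derivative of the normal component of a parallel form. The term `-λ v` comes from
the derivative of `N`; the normal parts of the derivatives of the tangent fields do not contribute
because `N` is already an argument of `σ`. -/
theorem covDeriv_pullbackInterior (hM : IsExtrinsicHypersphere i N lam) (hσ : IsSmoothForm σ)
    (hpar : IsParallel σ) (x : M) (v : TangentSpace (𝓡 n) x) :
    covDeriv (pullbackInterior i N σ) x v = (-lam) • interiorProd v (pullbackForm i σ x) := by
  ext w
  choose W hW hWi using fun j ↦ hM.exists_extension_tangent (w j)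
  obtain ⟨W₀, hW₀, hW₀i⟩ := hM.exists_extension_normal x
  have hWx : ∀ j, W j (i x) = mfderiv (𝓡 n) (𝓡 (n + 1)) i x (w j) := fun j ↦ by
    have h := (hWi j).self_of_nhds
    rwa [extend_apply_self] at h
  have hW₀x : W₀ (i x) = N x := hW₀i.self_of_nhds
  set L := mfderiv (𝓡 n) (𝓡 (n + 1)) i x
  let Z : Fin (p + 1) → Π z : Mbar, TangentSpace (𝓡 (n + 1)) z := Fin.cons W₀ W
  have hZd : ∀ j, MDifferentiableAt (𝓡 (n + 1)) (𝓡 (n + 1)).tangent (T% (Z j)) (i x) :=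
    Fin.cases (hW₀.mdifferentiableAt (by simp)) fun j ↦ (hW j).mdifferentiableAt (by simp)
  have hZx : (fun j ↦ Z j (i x)) = Matrix.vecCons (N x) (fun j ↦ L (w j)) := by
    funext j
    refine Fin.cases hW₀x (fun j ↦ ?_) j
    exact hWx j
  have h1 := mvfderiv_form_apply (hM.isSmoothForm_pullbackInterior hσ)
    (Y := fun j ↦ extend (EuclideanSpace ℝ (Fin n)) (w j)) (x := x)
    (fun j ↦ mdifferentiableAt_extend ..) v
  have h2 := mvfderiv_form_apply hσ hZd (L v)
  have h3 := mvfderiv_comp_eq_of_eventuallyEq (hM.mdifferentiableAt x)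
    (mdifferentiableAt_form_apply hσ hZd) (h' := fun y ↦ pullbackInterior i N σ y
      (fun j ↦ extend (EuclideanSpace ℝ (Fin n)) (w j) y)) (by
        filter_upwards [Filter.eventually_all.2 hWi, hW₀i] with y hy hy'
        refine congrArg (σ (i y)) (funext fun j ↦ ?_)
        refine Fin.cases ?_ (fun j ↦ ?_) j
        · exact hy'.symm
        · exact (hy j).symm) v
  have h4 := h1.symm.trans (h3.symm.trans h2)
  have h5 : (fun j ↦ extend (EuclideanSpace ℝ (Fin n)) (w j) x) = w := by
    funext j; exact extend_apply_self ..
  rw [hpar (i x) (L v), h5, hZx, Fin.sum_univ_succ] at h4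
  have h10 : ∀ m, pullbackForm i σ x m = σ (i x) (fun l ↦ L (m l)) := fun _ ↦ rfl
  have h6 : σ (i x) (Function.update (Matrix.vecCons (N x) (fun j ↦ L (w j))) 0
      (leviCivita (EuclideanSpace ℝ (Fin (n + 1))) Mbar (Z 0) (i x) (L v))) =
      -lam * interiorProd v (pullbackForm i σ x) w := by
    have hZ0 : leviCivita (EuclideanSpace ℝ (Fin (n + 1))) Mbar (Z 0) (i x) (L v) = -lam • L v :=
      hM.weingarten_formula v hW₀ hW₀i
    rw [hZ0, (σ (i x)).map_update_smul, interiorProd_apply, h10]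
    refine congrArg (-lam * σ (i x) ·) (funext fun l ↦ ?_)
    refine Fin.cases ?_ (fun l ↦ ?_) l
    · rfl
    · rfl
  have h7 : ∀ j : Fin p, σ (i x) (Function.update (Matrix.vecCons (N x) (fun j ↦ L (w j))) j.succ
      (leviCivita (EuclideanSpace ℝ (Fin (n + 1))) Mbar (Z j.succ) (i x) (L v))) =
      pullbackInterior i N σ x (Function.update w j (leviCivita (EuclideanSpace ℝ (Fin n)) M
        (extend (EuclideanSpace ℝ (Fin n)) (w j)) x v)) := by
    intro j
    have hZj : leviCivita (EuclideanSpace ℝ (Fin (n + 1))) Mbar (Z j.succ) (i x) (L v) = _ :=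
      hM.gauss_formula v (w j) (hW j) (hWi j)
    have h0 : σ (i x) (Function.update (Matrix.vecCons (N x) (fun j ↦ L (w j))) j.succ (N x)) = 0 :=
      by
      refine (σ (i x)).map_eq_zero_of_eq _ (i := 0) (j := j.succ) ?_ (Fin.succ_ne_zero j).symm
      rw [Function.update_self]
      exact Function.update_of_ne (Fin.succ_ne_zero j).symm _ _
    rw [hZj, (σ (i x)).map_update_add, (σ (i x)).map_update_smul, h0, smul_zero, add_zero]
    refine congrArg (σ (i x)) (funext fun l ↦ ?_)
    refine Fin.cases ?_ (fun l ↦ ?_) l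
    · rfl
    · change Function.update (Matrix.vecCons (N x) (fun j ↦ L (w j))) j.succ _ l.succ =
        L (Function.update w j _ l)
      by_cases h : l = j
      · subst h; simp [L]
      · rw [Function.update_of_ne (by simpa using h), Function.update_of_ne h]
        rfl
  rw [h6, Finset.sum_congr rfl fun j _ ↦ h7 j] at h4
  have h11 : ((-lam) • interiorProd v (pullbackForm i σ x)) w =
      -lam * interiorProd v (pullbackForm i σ x) w := rfl
  have h12 : (0 : TangentSpace (𝓡 (n + 1)) (i x) [⋀^Fin (p + 1)]→L[ℝ] ℝ)
      (Matrix.vecCons (N x) (fun j ↦ L (w j))) = 0 := rfl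
  rw [h11]
  rw [h12] at h4
  linarith

end IsExtrinsicHypersphere

end Hypersphere

/-! ### Derivatives of forms with prescribed covariant derivative -/

section CovariantDerivativeIdentities

variable {E : Type*} [NormedAddCommGroup E] [NormedSpace ℝ E] [FiniteDimensional ℝ E]
  {M : Type*} [TopologicalSpace M] [ChartedSpace E M] [IsManifold 𝓘(ℝ, E) ∞ M]
  [RiemannianBundle (fun x : M ↦ TangentSpace 𝓘(ℝ, E) x)]
  [IsContMDiffRiemannianBundle 𝓘(ℝ, E) ∞ E (fun x : M ↦ TangentSpace 𝓘(ℝ, E) x)]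
  {k : ℕ} {x : M} {c : ℝ}

theorem covDeriv_smul {α : FormField E M k} (hα : IsSmoothForm α) (c : ℝ) (x : M)
    (v : TangentSpace 𝓘(ℝ, E) x) : covDeriv (c • α) x v = c • covDeriv α x v := by
  have hd : DifferentiableAt ℝ (chartForm α x) (extChartAt 𝓘(ℝ, E) x x) :=
    ((isSmoothForm_iff α).1 hα x).differentiableAt (by simp)
  have h : fderiv ℝ (chartForm (c • α) x) (extChartAt 𝓘(ℝ, E) x x) =
      c • fderiv ℝ (chartForm α x) (extChartAt 𝓘(ℝ, E) x x) := fderiv_const_smul hd c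
  ext m
  have hl : covDeriv (c • α) x v m =
      fderiv ℝ (chartForm (c • α) x) (extChartAt 𝓘(ℝ, E) x x)
        (mvfderiv 𝓘(ℝ, E) (extChartAt 𝓘(ℝ, E) x) x v)
          (fun j ↦ mvfderiv 𝓘(ℝ, E) (extChartAt 𝓘(ℝ, E) x) x (m j)) -
      ∑ j, c * α x (Function.update m j (christoffel x v (m j))) := rfl
  have hr : (c • covDeriv α x v) m = c *
      (fderiv ℝ (chartForm α x) (extChartAt 𝓘(ℝ, E) x x)
        (mvfderiv 𝓘(ℝ, E) (extChartAt 𝓘(ℝ, E) x) x v)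
          (fun j ↦ mvfderiv 𝓘(ℝ, E) (extChartAt 𝓘(ℝ, E) x) x (m j)) -
      ∑ j, α x (Function.update m j (christoffel x v (m j)))) := rfl
  rw [hl, hr, h, ← Finset.mul_sum, mul_sub]
  rfl

theorem extD_eq_smul {α : FormField E M k} {β : FormField E M (k + 1)}
    (h : ∀ v, covDeriv α x v = c • interiorProd v (β x)) :
    extD α x = (c * (k + 1)) • β x := by
  ext m
  have h1 : ∀ j : Fin (k + 1), (-1 : ℝ) ^ (j : ℕ) * covDeriv α x (m j) (j.removeNth m) =
      c * ((-1 : ℝ) ^ (j : ℕ) * interiorProd (m j) (β x) (j.removeNth m)) := fun j ↦ by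
    rw [h]
    exact mul_left_comm _ c _
  rw [extD_apply, Finset.sum_congr rfl fun j _ ↦ h1 j, ← Finset.mul_sum, sum_interiorProd_removeNth]
  change _ = c * (k + 1) * β x m
  ring

theorem extD_eq_zero {α : FormField E M k} {β : FormField E M (k + 1)}
    (h : ∀ v, covDeriv β x v = c • wedge (flat v) (α x)) : extD β x = 0 := by
  ext m
  have h1 : ∀ j : Fin (k + 2), (-1 : ℝ) ^ (j : ℕ) * covDeriv β x (m j) (j.removeNth m) =
      c * ((-1 : ℝ) ^ (j : ℕ) * wedge (flat (m j)) (α x) (j.removeNth m)) := fun j ↦ by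
    rw [h]
    exact mul_left_comm _ c _
  rw [extD_apply, Finset.sum_congr rfl fun j _ ↦ h1 j, ← Finset.mul_sum]
  have h2 := sum_wedge_removeNth (flat (x := x)) (fun v w ↦ real_inner_comm w v)
    (fun v w ↦ ContinuousLinearMap.ext fun u ↦ inner_add_left v w u)
    (fun c v ↦ ContinuousLinearMap.ext fun u ↦ real_inner_smul_left v u c) (α x) m
  rw [h2, mul_zero]
  rfl

theorem codiff_eq_smul {α : FormField E M k} {β : FormField E M (k + 1)}
    (h : ∀ v, covDeriv β x v = c • wedge (flat v) (α x)) :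
    codiff β x = (-(c * (Module.finrank ℝ E - k))) • α x := by
  have h1 := sum_interiorProd_wedge (stdOrthonormalBasis ℝ (TangentSpace 𝓘(ℝ, E) x)) (α x)
  rw [Fintype.card_fin] at h1
  have h2 : ∀ v : TangentSpace 𝓘(ℝ, E) x, interiorProd v (covDeriv β x v) =
      c • interiorProd v (wedge (innerSL ℝ v) (α x)) := fun v ↦ by
    rw [h]
    rfl
  rw [codiff, Finset.sum_congr rfl fun j _ ↦ h2 _, ← Finset.smul_sum, h1, smul_smul]
  exact (neg_smul _ _).symm

theorem codiff_eq_zero {α : FormField E M (k + 1)} {β : FormField E M (k + 2)}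
    (h : ∀ v, covDeriv α x v = c • interiorProd v (β x)) : codiff α x = 0 := by
  have h2 : ∀ v : TangentSpace 𝓘(ℝ, E) x, interiorProd v (covDeriv α x v) = 0 := fun v ↦ by
    rw [h]
    refine Eq.trans (b := c • interiorProd v (interiorProd v (β x))) rfl ?_
    rw [interiorProd_self, smul_zero]
  rw [codiff, Finset.sum_congr rfl fun j _ ↦ h2 _, Finset.sum_const_zero, neg_zero]

theorem isCoclosed_of_covDeriv : ∀ {k : ℕ} {α : FormField E M k} {β : FormField E M (k + 1)},
    (∀ x v, covDeriv α x v = c • interiorProd v (β x)) → IsCoclosed α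
  | 0, _, _, _ => trivial
  | _ + 1, _, _, h => funext fun x ↦ codiff_eq_zero (h x)

end CovariantDerivativeIdentities

/-! ### The normal part is not parallel -/

section Hypersphere

variable {n : ℕ}
  {Mbar : Type*} [TopologicalSpace Mbar] [ChartedSpace (EuclideanSpace ℝ (Fin (n + 1))) Mbar]
  [IsManifold (𝓡 (n + 1)) ∞ Mbar]
  [RiemannianBundle (fun x : Mbar ↦ TangentSpace (𝓡 (n + 1)) x)]
  [IsContMDiffRiemannianBundle (𝓡 (n + 1)) ∞ (EuclideanSpace ℝ (Fin (n + 1)))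
    (fun x : Mbar ↦ TangentSpace (𝓡 (n + 1)) x)]
  {M : Type*} [EMetricSpace M] [ChartedSpace (EuclideanSpace ℝ (Fin n)) M]
  [IsManifold (𝓡 n) ∞ M]
  [RiemannianBundle (fun x : M ↦ TangentSpace (𝓡 n) x)]
  [IsContMDiffRiemannianBundle (𝓡 n) ∞ (EuclideanSpace ℝ (Fin n))
    (fun x : M ↦ TangentSpace (𝓡 n) x)]
  {i : M → Mbar} {N : Π x : M, TangentSpace (𝓡 (n + 1)) (i x)} {lam : ℝ} {p : ℕ}
  {σ : FormField (EuclideanSpace ℝ (Fin (n + 1))) Mbar (p + 1)}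

/-- A form on the ambient space is determined at a point of the hypersurface by its tangential and
normal components. -/
theorem IsExtrinsicHypersphere.apply_eq_zero (hM : IsExtrinsicHypersphere i N lam) {x : M}
    (hγ : pullbackInterior (E := EuclideanSpace ℝ (Fin n)) i N σ x = 0)
    (hβ : pullbackForm (E := EuclideanSpace ℝ (Fin n)) i σ x = 0) : σ (i x) = 0 := by
  set L := mfderiv (𝓡 n) (𝓡 (n + 1)) i x with hL
  have hdec : ∀ {q : ℕ} (m : Fin q → TangentSpace (𝓡 (n + 1)) (i x)),
      ∃ (v : Fin q → TangentSpace (𝓡 n) x) (t : Fin q → ℝ), m = fun j ↦ L (v j) + t j • N x := by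
    intro q m
    choose v t h using fun j ↦ hM.exists_eq_add_smul_normal x (m j)
    exact ⟨v, t, funext h⟩
  have h1 : interiorProd (N x) (σ (i x)) = 0 := by
    ext m
    obtain ⟨v, t, rfl⟩ := hdec m
    refine (alternating_add_smul_of_interiorProd_eq_zero (v := N x) (fun m j ↦ ?_) _ t).trans
      (DFunLike.congr_fun hγ v)
    exact (σ (i x)).map_eq_zero_of_eq _ (i := 0) (j := j.succ)
      (Function.update_self j (N x) m).symm (Fin.succ_ne_zero j).symm
  ext m
  obtain ⟨v, t, rfl⟩ := hdec m
  refine (alternating_add_smul_of_interiorProd_eq_zero (v := N x) (fun m j ↦ ?_) _ t).trans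
    (DFunLike.congr_fun hβ v)
  rw [alternating_update, h1]
  exact mul_zero _

/-- If the normal component of a parallel form is parallel, then the form vanishes along the
hypersurface. -/
theorem IsExtrinsicHypersphere.apply_eq_zero_of_isParallel (hM : IsExtrinsicHypersphere i N lam)
    (hp : p + 1 ≤ n) (hσ : IsSmoothForm σ) (hpar : IsParallel σ)
    (hγ : IsParallel (pullbackInterior (E := EuclideanSpace ℝ (Fin n)) i N σ)) (x : M) :
    σ (i x) = 0 := by
  have hβ : pullbackForm (E := EuclideanSpace ℝ (Fin n)) i σ = 0 := by
    funext y
    refine eq_zero_of_interiorProd fun v ↦ ?_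
    have h := hγ y v
    rw [hM.covDeriv_pullbackInterior hσ hpar] at h
    exact (smul_eq_zero.1 h).resolve_left (neg_ne_zero.2 hM.lam_ne_zero)
  refine hM.apply_eq_zero ?_ (congrFun hβ x)
  -- Two evaluations of `d^* β`: it is `-(n - p) λ γ`, and it is `0` since `β = 0`.
  have h1 := codiff_eq_smul (x := x) fun v ↦ hM.covDeriv_pullbackForm hσ hpar x v
  have h2 : codiff (pullbackForm (E := EuclideanSpace ℝ (Fin n)) i σ) x = 0 := by
    have h3 := codiff_eq_smul (c := 0) (α := pullbackInterior i N σ)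
      (β := pullbackForm (E := EuclideanSpace ℝ (Fin n)) i σ) (x := x) fun v ↦ by
        have h4 := covDeriv_smul (hM.isSmoothForm_pullbackForm hσ) 0 x v
        rw [zero_smul, ← hβ] at h4
        rw [h4, zero_smul, zero_smul]
    rw [h3, zero_mul, neg_zero, zero_smul]
  rw [h2] at h1
  refine (smul_eq_zero.1 h1.symm).resolve_left (neg_ne_zero.2 (mul_ne_zero hM.lam_ne_zero ?_))
  have h5 : ((p : ℝ) + 1) ≤ n := by exact_mod_cast hp
  rw [finrank_euclideanSpace_fin]
  linarith

end Hypersphere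

end RiemGeom

end

/-- Here the degree is `k = p + 1`, so that `γ` is a `p`-form. -/
theorem lemma3p1 {n p : ℕ} (hp : p + 1 ≤ n)
    {Mbar : Type*} [TopologicalSpace Mbar] [T2Space Mbar] [ConnectedSpace Mbar]
    [ChartedSpace (EuclideanSpace ℝ (Fin (n + 1))) Mbar] [IsManifold (𝓡 (n + 1)) ∞ Mbar]
    [RiemannianBundle (fun x : Mbar ↦ TangentSpace (𝓡 (n + 1)) x)]
    [IsContMDiffRiemannianBundle (𝓡 (n + 1)) ∞ (EuclideanSpace ℝ (Fin (n + 1)))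
      (fun x : Mbar ↦ TangentSpace (𝓡 (n + 1)) x)]
    {M : Type*} [Nonempty M] [EMetricSpace M]
    [ChartedSpace (EuclideanSpace ℝ (Fin n)) M] [IsManifold (𝓡 n) ∞ M]
    [RiemannianBundle (fun x : M ↦ TangentSpace (𝓡 n) x)]
    [IsContMDiffRiemannianBundle (𝓡 n) ∞ (EuclideanSpace ℝ (Fin n))
      (fun x : M ↦ TangentSpace (𝓡 n) x)]
    [IsRiemannianManifold (𝓡 n) M]
    (i : M → Mbar) (N : Π x : M, TangentSpace (𝓡 (n + 1)) (i x)) (lam : ℝ)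
    (hM : RiemGeom.IsExtrinsicHypersphere i N lam)
    (σ : RiemGeom.FormField (EuclideanSpace ℝ (Fin (n + 1))) Mbar (p + 1))
    (hσ : RiemGeom.IsSmoothForm σ) (hσ_par : RiemGeom.IsParallel σ) (hσ_ne : σ ≠ 0)
    (γ : RiemGeom.FormField (EuclideanSpace ℝ (Fin n)) M p)
    (hγ : γ = RiemGeom.pullbackInterior i N σ)
    (β : RiemGeom.FormField (EuclideanSpace ℝ (Fin n)) M (p + 1))
    (hβ : β = RiemGeom.pullbackForm i σ)
    (k : ℝ) (hk : k = p + 1) :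
    RiemGeom.IsSmoothForm γ ∧ RiemGeom.IsSmoothForm β ∧
    (∀ (x : M) (X : TangentSpace (𝓡 n) x),
      RiemGeom.covDeriv γ x X = (1 / k) • RiemGeom.interiorProd X (RiemGeom.extD γ x)) ∧
    (∀ (x : M) (X : TangentSpace (𝓡 n) x),
      RiemGeom.covDeriv (RiemGeom.extD γ) x X =
        (-(k * lam ^ 2)) • RiemGeom.wedge (RiemGeom.flat X) (γ x)) ∧
    (∀ (x : M) (X : TangentSpace (𝓡 n) x),
      RiemGeom.covDeriv β x X =
        (-(1 / (n - k + 1))) • RiemGeom.wedge (RiemGeom.flat X) (RiemGeom.codiff β x)) ∧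
    (∀ (x : M) (X : TangentSpace (𝓡 n) x),
      RiemGeom.covDeriv (RiemGeom.codiff β) x X =
        ((n - k + 1) * lam ^ 2) • RiemGeom.interiorProd X (β x)) ∧
    RiemGeom.extD γ = (-(k * lam)) • β ∧
    RiemGeom.codiff β = (-((n - k + 1) * lam)) • γ ∧
    RiemGeom.IsCoclosed γ ∧
    RiemGeom.extD β = 0 ∧
    ¬ RiemGeom.IsParallel γ := by
  have hγ' := hM.isSmoothForm_pullbackInterior hσ
  have hβ' := hM.isSmoothForm_pullbackForm hσ
  have dγ : ∀ x X, RiemGeom.covDeriv γ x X = (-lam) • RiemGeom.interiorProd X (β x) := by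
    subst hγ hβ
    exact hM.covDeriv_pullbackInterior hσ hσ_par
  have dβ : ∀ x X, RiemGeom.covDeriv β x X = lam • RiemGeom.wedge (RiemGeom.flat X) (γ x) := by
    subst hγ hβ
    exact hM.covDeriv_pullbackForm hσ hσ_par
  rw [← hγ] at hγ'
  rw [← hβ] at hβ'
  have hk0 : k ≠ 0 := by rw [hk]; positivity
  have hnk : (n : ℝ) - k + 1 ≠ 0 := by
    have h : ((p : ℝ) + 1) ≤ n := by exact_mod_cast hp
    rw [hk]
    linarith
  have hextD : RiemGeom.extD γ = (-(k * lam)) • β := by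
    funext x
    rw [RiemGeom.extD_eq_smul (dγ x), ← hk, Pi.smul_apply]
    congr 1
    ring
  have hcodiff : RiemGeom.codiff β = (-((n - k + 1) * lam)) • γ := by
    funext x
    rw [RiemGeom.codiff_eq_smul (dβ x), finrank_euclideanSpace_fin, Pi.smul_apply, hk]
    congr 1
    ring
  refine ⟨hγ', hβ', fun x X ↦ ?_, fun x X ↦ ?_, fun x X ↦ ?_, fun x X ↦ ?_, hextD, hcodiff,
    RiemGeom.isCoclosed_of_covDeriv dγ, funext fun x ↦ RiemGeom.extD_eq_zero (dβ x), fun h ↦ ?_⟩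
  · have h : RiemGeom.interiorProd X (RiemGeom.extD γ x) =
        (-(k * lam)) • RiemGeom.interiorProd X (β x) := by rw [hextD]; rfl
    rw [dγ, h, smul_smul]
    congr 1
    field_simp
  · rw [hextD, RiemGeom.covDeriv_smul hβ', dβ, smul_smul]
    congr 1
    ring
  · have h : RiemGeom.codiff β x = (-((n - k + 1) * lam)) • γ x := by rw [hcodiff]; rfl
    rw [dβ, h, RiemGeom.wedge_smul_right, smul_smul]
    congr 1
    field_simp
  · rw [hcodiff, RiemGeom.covDeriv_smul hγ', dγ, smul_smul]
    congr 1
    ring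
  · obtain ⟨x⟩ := ‹Nonempty M›
    subst hγ
    exact hσ_ne (hσ_par.eq_zero_of_apply_eq_zero hσ
      (hM.apply_eq_zero_of_isParallel hp hσ hσ_par h x))
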